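/- Let $\sigma$ be the surface measure on the unit sphere $\mathbb S^2\subset\mathbb R^3$, normalised to total mass $1$, and let $\Delta$ be the Laplace–Beltrami operator on $\mathbb S^2$. For $n\ge 0$ let $\mathrm{proj}_n$ be the orthogonal projection of $L^2(\mathbb S^2)$ onto the subspace spanned by the eigenfunctions of $-\Delta$ with eigenvalue $n(n+1)$. Put $$e^{it\Delta}f=\sum_{n\ge 0}e^{-itn(n+1)}\,\mathrm{proj}_nf,\qquad P_Nf=\sum_{N\le n<2N}\mathrm{proj}_nf .$$ Let $Y_n=\sqrt{2n+1}\,P_n(\cos\theta)$ be the zonal harmonic of degree $n$, where $\cos\theta=x_3$ and $P_n$ is the Legendre polynomial of degree $n$. For $s\ge 0$ let $H^s(\mathbb S^2)$ be the space of all $f\in L^2(\mathbb S^2)$ such that $\sum_{N}N^{2s}\|P_Nf\|_{L^2}^2<\infty$, the sum being over $N\in\{1,2,4,8,\dots\}$, and let $$\mathcal Z^s=\Big\{f\in H^s(\mathbb S^2):\ f=\sum_{n\ge 0}a_nY_n \text{ in } L^2(\mathbb S^2)\text{ for some } a_n\in\mathbb C\Big\}.$$ **Lemma (improved bilinear Strichartz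 estimate).** For every $\varepsilon>0$ there is a constant $C_\varepsilon>0$, depending only on $\varepsilon$, such that for all $s\ge0$, all $f,g\in\mathcal Z^s$ and all dyadic numbers $N\ge M$ (that is, $N,M\in\{1,2,4,8,\dots\}$) $$\Big(\int_0^{2\pi}\!\!\int_{\mathbb S^2}\big|P_N(e^{it\Delta}f)(x)\;P_M(e^{it\Delta}g)(x)\big|^2\,d\sigma(x)\,dt\Big)^{1/2}\le C_\varepsilon\,M^{\varepsilon}\,\|P_Nf\|_{L^2(\mathbb S^2)}\,\|P_Mg\|_{L^2(\mathbb S^2)} .$$ In particular ($s=0$) the estimate holds for all $f,g\in L^2(\mathbb S^2)$ that are $L^2$-convergent series of zonal harmonics. -/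

import Mathlib

open MeasureTheory
open scoped ENNReal ContDiff

noncomputable section

/-- The ambient Euclidean space of the two-sphere. -/
abbrev E3 : Type := EuclideanSpace ℝ (Fin 3)

/-- The unit sphere `𝕊²` in three-dimensional Euclidean space. -/
abbrev S2 : Type := Metric.sphere (0 : E3) 1

/-- The surface measure on `𝕊²`, normalised to have total mass one. -/
def sigma : Measure S2 :=
  ((volume : Measure E3).toSphere Set.univ)⁻¹ • (volume : Measure E3).toSphere

instance sigma_isProbabilityMeasure : IsProbabilityMeasure sigma := by
  refine ⟨?_⟩
  have h0 : (volume : Measure E3).toSphere Set.univ ≠ 0 := by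
    rw [Ne, Measure.measure_univ_eq_zero]
    exact Measure.toSphere_ne_zero _
  have h1 : (volume : Measure E3).toSphere Set.univ ≠ ⊤ := measure_ne_top _ _
  simp only [sigma, Measure.smul_apply, smul_eq_mul]
  exact ENNReal.inv_mul_cancel h0 h1

/-- The Hilbert space `L²(𝕊²)` of complex-valued functions, for the normalised measure. -/
abbrev L2S2 : Type := Lp ℂ 2 sigma

/-- The extension of a function on `𝕊²` to a function on `ℝ³ \ {0}` that is constant along rays
(with the value `0` at the origin). -/
def radialExtension (φ : S2 → ℂ) (y : E3) : ℂ :=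
  open Classical in
  if h : y = 0 then 0
  else φ ⟨‖y‖⁻¹ • y, by simp [norm_smul, h]⟩

/-- Smoothness of a function on `𝕊²`, expressed through the extension constant along rays. -/
def SmoothOnS2 (φ : S2 → ℂ) : Prop :=
  ContDiffOn ℝ ∞ (radialExtension φ) {0}ᶜ

/-- The Laplace-Beltrami operator of the round sphere: the restriction to `𝕊²` of the Euclidean
Laplacian of the extension constant along rays. -/
def laplaceBeltrami (φ : S2 → ℂ) (x : S2) : ℂ :=
  Laplacian.laplacian (radialExtension φ) (x : E3)

/-- The subspace `E_{n(n+1)}` of `L²(𝕊²)` spanned by the eigenfunctions of minus the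
Laplace-Beltrami operator with eigenvalue `n (n + 1)`. -/
def eigenspaceS2 (n : ℕ) : Submodule ℂ L2S2 :=
  Submodule.span ℂ {u : L2S2 | ∃ φ : S2 → ℂ, SmoothOnS2 φ ∧
    (∀ x, -laplaceBeltrami φ x = ((n * (n + 1) : ℕ) : ℂ) * φ x) ∧ u =ᵐ[sigma] φ}

/-- The orthogonal projection of `L²(𝕊²)` onto the `n`-th eigenspace. (That space is finite
dimensional, so that taking its closure changes nothing.) -/
def proj (n : ℕ) : L2S2 →L[ℂ] L2S2 :=
  (eigenspaceS2 n).topologicalClosure.starProjection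

/-- The Schrödinger propagator `e^{i t Δ} f = ∑ₙ e^{-i t n (n + 1)} projₙ f`, a series in
`L²(𝕊²)`; the Laplace-Beltrami operator acts as `-n (n + 1)` on the `n`-th eigenspace. -/
def schrodinger (t : ℝ) (f : L2S2) : L2S2 :=
  ∑' n : ℕ, Complex.exp (-(Complex.I * (t : ℂ) * ((n * (n + 1) : ℕ) : ℂ))) • proj n f

/-- The sharp Littlewood-Paley projection to the frequencies `N ≤ n < 2 N`. -/
def littlewoodPaley (N : ℕ) (f : L2S2) : L2S2 :=
  ∑ n ∈ Finset.Ico N (2 * N), proj n f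

/-- The Legendre polynomial of degree `n`, by the formula of Rodrigues. -/
def legendre (n : ℕ) : Polynomial ℝ :=
  Polynomial.C (((2 : ℝ) ^ n * (n.factorial : ℝ))⁻¹) *
    Polynomial.derivative^[n] ((Polynomial.X ^ 2 - 1) ^ n)

/-- The zonal harmonic `Y_n(x) = √(2 n + 1) P_n(x₃) = √(2 n + 1) P_n(cos θ)`, as a function. -/
def zonalFun (n : ℕ) (x : S2) : ℂ :=
  ((Real.sqrt (2 * n + 1) * (legendre n).eval ((x : E3) 2) : ℝ) : ℂ)

theorem continuous_zonalFun (n : ℕ) : Continuous (zonalFun n) := by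
  unfold zonalFun
  have h : Continuous fun x : S2 => (x : E3) 2 := by fun_prop
  exact Complex.continuous_ofReal.comp
    (continuous_const.mul ((legendre n).continuous.comp h))

theorem memLp_zonalFun (n : ℕ) : MemLp (zonalFun n) 2 sigma := by
  obtain ⟨C, hC⟩ := isCompact_univ.exists_bound_of_continuousOn
    (continuous_zonalFun n).continuousOn
  exact MemLp.of_bound (continuous_zonalFun n).aestronglyMeasurable C
    (Filter.Eventually.of_forall fun x => hC x (Set.mem_univ x))

/-- The zonal harmonic of degree `n` as an element of `L²(𝕊²)`. -/
def zonalHarmonic (n : ℕ) : L2S2 := (memLp_zonalFun n).toLp (zonalFun n)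

/-- Membership in the Sobolev space `H^s(𝕊²)`, `s ≥ 0`: the sum of `N^{2 s} ‖P_N f‖²` over the
dyadic numbers `N = 2 ^ j` is finite. -/
def MemSobolev (s : ℝ) (f : L2S2) : Prop :=
  Summable fun j : ℕ => ((2 : ℝ) ^ j) ^ (2 * s) * ‖littlewoodPaley (2 ^ j) f‖ ^ 2

/-- The space `𝒵^s(𝕊²)`, `s ≥ 0`, of the functions in `H^s(𝕊²)` that are supported on the zonal
harmonics, `f = ∑ₙ aₙ Y_n`. -/
def zonalSobolev (s : ℝ) : Set L2S2 :=
  {f | MemSobolev s f ∧ ∃ a : ℕ → ℂ, HasSum (fun n => a n • zonalHarmonic n) f}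

/-- The norm in `L²(𝕊² × [0, 2π])`, as an iterated integral with values in `[0, ∞]`. -/
def spaceTimeL2 (F : ℝ → S2 → ℂ) : ℝ≥0∞ :=
  (∫⁻ t in Set.Icc (0 : ℝ) (2 * Real.pi), ∫⁻ x, ‖F t x‖ₑ ^ 2 ∂sigma) ^ (1 / 2 : ℝ)

end

/-! The product of the two evolutions is a finite sum over pairs `(n, m)` of `aₙ bₘ Yₙ Yₘ` with
phase frequency `n(n+1) + m(m+1)`, an integer. Integrating in time first, at fixed `x`, kills all
cross terms between different frequencies. If every frequency is attained by at most `K` pairs, the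
time integral is at most `2πK ∑ |aₙ bₘ|² |Yₙ Yₘ|²` (`integral_norm_sq_exp_sum_le`). It remains to
bound `K` and `∫ |Yₙ Yₘ|²` by `M^ε` each.

Counting: the equation for frequency `k` reads `(2n+1)² + (2m+1)² = 4k + 2`, so pairs inject into
Gaussian integers of norm `4k + 2`, of which there are at most four times the number of divisors,
hence `O(k^ε)`. To get a power of `M` rather than of `N`, two regimes are separated: if `N ≥ 2M²`,
consecutive values of `n(n+1)` are too far apart for `m` to compensate and `K = 1`; otherwise `k` is
`O(M⁴)` (`exists_card_resonantPairs_le`).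

Space: the third coordinate is uniformly distributed on `[-1, 1]` (`two_mul_sphereMean`), so the
integral is one of Legendre polynomials. Bernstein's inequality alone bounds `Yₙ² Yₘ²` by a multiple
of `1/(1-x²)`, which just fails to be integrable. Interpolating a small power of the factor `Yₘ²`
with `|Pₘ| ≤ 1` makes the weight integrable at the cost of `m^δ` (`weighted_legendre_sq_mul_sq_le`).

The link with the abstract projections is Green's identity on the sphere: `Yₙ` lies in the `n`-th
eigenspace and is orthogonal to all the others, which determines every projection of a zonal series
without a description of the full eigenspaces. -/

/-! ### The divisor bound. -/

/-- The quotient `d(n) / n^ε` is the product of `(e+1) / p^(εe)` over the prime powers `p^e` exactly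
dividing `n`. A prime with `p^ε ≥ 2` contributes at most `1`; each of the fewer than `B` smaller
primes contributes at most `A`. -/
theorem exists_card_divisors_le_rpow {ε : ℝ} (hε : 0 < ε) :
    ∃ C : ℝ, 0 < C ∧ ∀ n : ℕ, n ≠ 0 → (n.divisors.card : ℝ) ≤ C * (n : ℝ) ^ ε := by
  obtain ⟨B, hB⟩ := exists_nat_gt ((2 : ℝ) ^ (1 / ε))
  have hlog : 0 < Real.log 2 := Real.log_pos one_lt_two
  set A : ℝ := 1 + 1 / (ε * Real.log 2) with hA
  have hA1 : 1 ≤ A := by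
    have : 0 < 1 / (ε * Real.log 2) := by positivity
    linarith
  refine ⟨A ^ B, by positivity, fun n hn => ?_⟩
  have hpow : (n : ℝ) ^ ε = ∏ p ∈ n.primeFactors, ((p : ℝ) ^ ε) ^ (n.factorization p) := by
    conv_lhs => rw [← Nat.prod_factorization_pow_eq_self hn]
    rw [Finsupp.prod, Nat.support_factorization, Nat.cast_prod,
      ← Real.finsetProd_rpow _ _ (fun _ _ => by positivity)]
    refine Finset.prod_congr rfl fun p _ => ?_
    rw [Nat.cast_pow, ← Real.rpow_natCast, ← Real.rpow_mul (by positivity), mul_comm,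
      Real.rpow_mul (by positivity), Real.rpow_natCast]
  have hsmall : ∀ p : ℕ, 2 ≤ p → ∀ e : ℕ, ((e + 1 : ℕ) : ℝ) ≤ A * ((p : ℝ) ^ ε) ^ e := by
    intro p hp e
    have h2 : (2 : ℝ) ^ ε ≤ (p : ℝ) ^ ε :=
      Real.rpow_le_rpow (by norm_num) (by exact_mod_cast hp) hε.le
    have h3 : 1 + (e : ℝ) * (ε * Real.log 2) ≤ ((2 : ℝ) ^ ε) ^ e := by
      rw [Real.rpow_def_of_pos two_pos, ← Real.exp_nat_mul]
      have := Real.add_one_le_exp ((e : ℝ) * (Real.log 2 * ε))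
      nlinarith
    have h4 : ((2 : ℝ) ^ ε) ^ e ≤ ((p : ℝ) ^ ε) ^ e := by gcongr
    have hc : 0 < ε * Real.log 2 := by positivity
    calc ((e + 1 : ℕ) : ℝ) ≤ A * (1 + (e : ℝ) * (ε * Real.log 2)) := by
          rw [hA]
          have : (1 + 1 / (ε * Real.log 2)) * (1 + (e : ℝ) * (ε * Real.log 2))
            = 1 + e + e * (ε * Real.log 2) + 1 / (ε * Real.log 2) := by field_simp; ring
          rw [this]; push_cast
          have : 0 ≤ (e : ℝ) * (ε * Real.log 2) := by positivity
          have : 0 ≤ 1 / (ε * Real.log 2) := by positivity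
          linarith
      _ ≤ A * ((p : ℝ) ^ ε) ^ e := by gcongr; exact h3.trans h4
  have hlarge : ∀ p : ℕ, B ≤ p → ∀ e : ℕ, ((e + 1 : ℕ) : ℝ) ≤ ((p : ℝ) ^ ε) ^ e := by
    intro p hp e
    have h2 : (2 : ℝ) ≤ (p : ℝ) ^ ε := by
      calc (2 : ℝ) = ((2 : ℝ) ^ (1 / ε)) ^ ε := by
            rw [← Real.rpow_mul (by norm_num)]; field_simp; simp
        _ ≤ _ := Real.rpow_le_rpow (by positivity) (hB.le.trans (by exact_mod_cast hp)) hε.le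
    calc ((e + 1 : ℕ) : ℝ) ≤ (2 : ℝ) ^ e := by exact_mod_cast Nat.lt_two_pow_self
      _ ≤ _ := by gcongr
  rw [Nat.card_divisors hn, hpow, Nat.cast_prod]
  calc ∏ p ∈ n.primeFactors, ((n.factorization p + 1 : ℕ) : ℝ)
      ≤ ∏ p ∈ n.primeFactors, ((if p < B then A else 1) * ((p : ℝ) ^ ε) ^ (n.factorization p)) := by
        refine Finset.prod_le_prod (fun _ _ => by positivity) fun p hp => ?_
        split_ifs with h
        · exact hsmall p (Nat.prime_of_mem_primeFactors hp).two_le _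
        · rw [one_mul]; exact hlarge p (not_lt.mp h) _
    _ = (∏ p ∈ n.primeFactors, (if p < B then A else 1)) *
          ∏ p ∈ n.primeFactors, ((p : ℝ) ^ ε) ^ (n.factorization p) := Finset.prod_mul_distrib
    _ ≤ _ := by
        gcongr
        · rw [← Finset.prod_filter, Finset.prod_const]
          refine pow_le_pow_right₀ hA1 ?_
          calc _ ≤ (Finset.range B).card := Finset.card_le_card (by
                intro p hp; simp at hp ⊢; exact hp.2)
            _ = B := Finset.card_range B

/-! ### Gaussian integers of given norm. -/

theorem finite_gaussianInt_norm_eq (n : ℤ) : {z : GaussianInt | z.norm = n}.Finite := by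
  refine Set.Finite.of_finite_image (f := fun z : GaussianInt => (z.re, z.im))
    (Set.Finite.subset ((Set.finite_Icc (-n) n).prod (Set.finite_Icc (-n) n)) ?_)
    (fun z _ w _ h => by simp only [Prod.mk.injEq] at h; exact Zsqrtd.ext h.1 h.2)
  rintro _ ⟨z, hz, rfl⟩
  simp only [Set.mem_ofPred_eq, Zsqrtd.norm] at hz
  simp only [Set.mem_prod, Set.mem_Icc]
  have habs : ∀ a : ℤ, |a| ≤ a * a := fun a => by
    rw [Int.abs_eq_natAbs, ← sq]
    exact Int.natAbs_le_self_sq a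
  have h1 := habs z.re
  have h2 := habs z.im
  refine ⟨abs_le.mp ?_, abs_le.mp ?_⟩ <;> nlinarith [mul_self_nonneg z.re, mul_self_nonneg z.im]

/-- The Gaussian integers of a given norm. -/
noncomputable def gaussianOfNorm (n : ℤ) : Finset GaussianInt := (finite_gaussianInt_norm_eq n).toFinset

theorem mem_gaussianOfNorm {n : ℤ} {z : GaussianInt} : z ∈ gaussianOfNorm n ↔ z.norm = n := by
  simp [gaussianOfNorm]

theorem GaussianInt.prime_of_norm_prime {p : ℕ} (hp : p.Prime) {π : GaussianInt}
    (hπ : π.norm = p) : Prime π := by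
  rw [← irreducible_iff_prime]
  refine ⟨fun hu => ?_, fun a b hab => ?_⟩
  · rw [← Zsqrtd.norm_eq_one_iff, hπ] at hu
    exact hp.one_lt.ne' (by simpa using hu)
  · rw [← Zsqrtd.norm_eq_one_iff, ← Zsqrtd.norm_eq_one_iff]
    have h : a.norm.natAbs * b.norm.natAbs = p := by
      rw [← Int.natAbs_mul, ← Zsqrtd.norm_mul, ← hab, hπ]; simp
    have := (Nat.prime_mul_iff.mp (h ▸ hp))
    tauto

theorem GaussianInt.dvd_norm_of_norm_eq {p : ℕ} {π z : GaussianInt} (hπ : π.norm = p)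
    (h : (p : ℤ) ∣ z.norm) : π ∣ z * star z := by
  have h1 : π ∣ ((p : ℤ) : GaussianInt) := by
    rw [← hπ, Zsqrtd.norm_eq_mul_conj]; exact dvd_mul_right _ _
  rw [← Zsqrtd.norm_eq_mul_conj]
  exact h1.trans (Int.cast_dvd_cast _ _ h)

/-- Unique factorisation in `ℤ[i]`, one rational prime at a time. If `p` is a norm, `p = π π̄`, the
candidates are `π^i π̄^(e-i)`; this includes `p = 2`. Otherwise `p` stays prime with norm `p²`, so
the only candidate is `p^(e/2)`, and there is none for odd `e`. -/
theorem exists_gaussian_divisors_prime_pow {p : ℕ} (hp : p.Prime) (e : ℕ) :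
    ∃ S : Finset GaussianInt, S.card ≤ e + 1 ∧ (∀ s ∈ S, s.norm = (p : ℤ) ^ e) ∧
      ∀ z : GaussianInt, ∀ l : ℤ, ¬ (p : ℤ) ∣ l → z.norm = (p : ℤ) ^ e * l → ∃ s ∈ S, s ∣ z := by
  classical
  have hp0 : (p : ℤ) ≠ 0 := by exact_mod_cast hp.ne_zero
  by_cases hsplit : ∃ π : GaussianInt, π.norm = p
  · obtain ⟨π, hπ⟩ := hsplit
    have hprime := GaussianInt.prime_of_norm_prime hp hπ
    have hπ' : (star π).norm = p := by rw [Zsqrtd.norm_conj, hπ]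
    refine ⟨(Finset.range (e + 1)).image fun i => π ^ i * star π ^ (e - i),
      Finset.card_image_le.trans (by simp), ?_, ?_⟩
    · intro s hs
      obtain ⟨i, hi, rfl⟩ := Finset.mem_image.mp hs
      have hi' : i ≤ e := by simpa [Nat.lt_succ_iff] using hi
      have hpw : ∀ (x : GaussianInt) (j : ℕ), (x ^ j).norm = x.norm ^ j := fun x j =>
        map_pow Zsqrtd.normMonoidHom x j
      rw [Zsqrtd.norm_mul, hpw, hpw, hπ, hπ', ← pow_add, Nat.add_sub_cancel' hi']
    · intro z l _ hz
      suffices h : ∃ i ≤ e, π ^ i * star π ^ (e - i) ∣ z by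
        obtain ⟨i, hi, h⟩ := h
        exact ⟨_, Finset.mem_image_of_mem _ (by simpa [Nat.lt_succ_iff] using hi), h⟩
      clear * - hz hπ hπ' hprime hp0
      induction e generalizing z with
      | zero => exact ⟨0, le_rfl, by simp⟩
      | succ e ih =>
        have hdvd : (p : ℤ) ∣ z.norm := by rw [hz, pow_succ, mul_assoc, mul_left_comm]; simp
        rcases hprime.dvd_or_dvd (GaussianInt.dvd_norm_of_norm_eq hπ hdvd) with h | h
        · obtain ⟨w, rfl⟩ := h
          rw [Zsqrtd.norm_mul, hπ, pow_succ, mul_assoc, mul_left_comm] at hz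
          obtain ⟨i, hi, h⟩ := ih w (mul_left_cancel₀ hp0 hz)
          refine ⟨i + 1, by omega, ?_⟩
          rw [Nat.add_sub_add_right, pow_succ', mul_assoc]
          exact mul_dvd_mul_left _ h
        · have h' : star π ∣ z := by
            obtain ⟨w, hw⟩ := h
            exact ⟨star w, by rw [← star_star z, hw, star_mul, mul_comm]⟩
          obtain ⟨w, rfl⟩ := h'
          rw [Zsqrtd.norm_mul, hπ', pow_succ, mul_assoc, mul_left_comm] at hz
          obtain ⟨i, hi, h⟩ := ih w (mul_left_cancel₀ hp0 hz)
          refine ⟨i, by omega, ?_⟩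
          rw [Nat.succ_sub hi, pow_succ', mul_left_comm]
          exact mul_dvd_mul_left _ h
  · have : Fact p.Prime := ⟨hp⟩
    have hirr : Irreducible (p : GaussianInt) := by
      by_contra hcon
      obtain ⟨a, b, hab⟩ := GaussianInt.sq_add_sq_of_nat_prime_of_not_irreducible p hcon
      refine hsplit ⟨⟨a, b⟩, ?_⟩
      rw [← hab]; simp [Zsqrtd.norm]; ring
    have hprime := irreducible_iff_prime.mp hirr
    have hnorm : (p : GaussianInt).norm = (p : ℤ) * p := Zsqrtd.norm_natCast _
    have hdiv : ∀ z : GaussianInt, (p : ℤ) ∣ z.norm → (p : GaussianInt) ∣ z := by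
      intro z hz
      have h1 : (p : GaussianInt) ∣ z * star z := by
        rw [← Zsqrtd.norm_eq_mul_conj]
        have := Int.cast_dvd_cast (α := GaussianInt) _ _ hz
        simpa using this
      rcases hprime.dvd_or_dvd h1 with h | ⟨w, hw⟩
      · exact h
      · exact ⟨star w, by rw [← star_star z, hw, star_mul, star_natCast, mul_comm]⟩
    induction e using Nat.twoStepInduction with
    | zero => exact ⟨{1}, by simp, by simp, fun z l _ _ => ⟨1, by simp, one_dvd _⟩⟩
    | one =>
      -- An inert prime cannot divide a norm exactly once: `p ∣ z` forces `p²` to divide the norm,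
      -- hence `p ∣ l`.
      refine ⟨∅, by simp, by simp, fun z l hl hz => (hl ?_).elim⟩
      obtain ⟨w, rfl⟩ := hdiv z (by rw [hz, pow_one]; simp)
      rw [Zsqrtd.norm_mul, hnorm, pow_one, mul_assoc] at hz
      exact ⟨_, (mul_left_cancel₀ hp0 hz).symm⟩
    | more e ih _ =>
      obtain ⟨S, hS, hSn, hSd⟩ := ih
      refine ⟨S.image ((p : GaussianInt) * ·), Finset.card_image_le.trans (by omega), ?_, ?_⟩
      · intro s hs
        obtain ⟨w, hw, rfl⟩ := Finset.mem_image.mp hs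
        rw [Zsqrtd.norm_mul, hnorm, hSn w hw]; ring
      · intro z l hl hz
        obtain ⟨w, rfl⟩ := hdiv z (by rw [hz, pow_succ, mul_assoc, mul_left_comm]; simp)
        rw [Zsqrtd.norm_mul, hnorm] at hz
        obtain ⟨s, hs, h⟩ := hSd w l hl
          (mul_left_cancel₀ (mul_ne_zero hp0 hp0) (hz.trans (by ring)))
        exact ⟨_, Finset.mem_image_of_mem _ hs, mul_dvd_mul_left _ h⟩

/-- Peeling off one prime power `p^e` costs a factor `e + 1`, exactly its factor in the divisor
function; the `4` counts the units left at the end. -/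
theorem card_gaussianOfNorm_le (n : ℕ) (hn : n ≠ 0) :
    (gaussianOfNorm n).card ≤ 4 * n.divisors.card := by
  classical
  induction n using Nat.recOnPrimePow with
  | zero => exact absurd rfl hn
  | one =>
    have hsub : gaussianOfNorm (1 : ℕ) ⊆ {⟨1, 0⟩, ⟨-1, 0⟩, ⟨0, 1⟩, ⟨0, -1⟩} := by
      intro z hz
      rw [mem_gaussianOfNorm] at hz
      obtain ⟨a, b⟩ := z
      simp only [Zsqrtd.norm, Nat.cast_one] at hz
      have ha : -1 ≤ a ∧ a ≤ 1 := by constructor <;> nlinarith [mul_self_nonneg b]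
      have hb : -1 ≤ b ∧ b ≤ 1 := by constructor <;> nlinarith [mul_self_nonneg a]
      obtain ⟨ha1, ha2⟩ := ha
      obtain ⟨hb1, hb2⟩ := hb
      interval_cases a <;> interval_cases b <;> simp_all
    exact (Finset.card_le_card hsub).trans ((Finset.card_le_four).trans (by simp))
  | prime_pow_mul a p e hp hpa he ih =>
    have ha : a ≠ 0 := right_ne_zero_of_mul hn
    obtain ⟨S, hS, hSn, hSd⟩ := exists_gaussian_divisors_prime_pow hp e
    have hsub : gaussianOfNorm (p ^ e * a : ℕ) ⊆
        Finset.image₂ (· * ·) S (gaussianOfNorm a) := by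
      intro z hz
      rw [mem_gaussianOfNorm] at hz
      push_cast at hz
      obtain ⟨s, hs, w, rfl⟩ := hSd z a (by exact_mod_cast hpa) hz
      refine Finset.mem_image₂_of_mem hs (mem_gaussianOfNorm.mpr ?_)
      rw [Zsqrtd.norm_mul, hSn s hs] at hz
      exact mul_left_cancel₀ (pow_ne_zero _ (by exact_mod_cast hp.ne_zero)) hz
    have hcop : (p ^ e).Coprime a := Nat.Coprime.pow_left _ ((hp.coprime_iff_not_dvd).mpr hpa)
    calc (gaussianOfNorm (p ^ e * a : ℕ)).card ≤ S.card * (gaussianOfNorm a).card :=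
          (Finset.card_le_card hsub).trans (Finset.card_image₂_le _ _ _)
      _ ≤ (e + 1) * (4 * a.divisors.card) := Nat.mul_le_mul hS (ih ha)
      _ = 4 * (p ^ e * a).divisors.card := by
          rw [hcop.card_divisors_mul, Nat.divisors_prime_pow hp, Finset.card_map,
            Finset.card_range]
          ring

/-! ### Counting resonant pairs. -/

/-- The frequency pairs of size `N` and `M` on a given level set of the resonance function. -/
def resonantPairs (N M k : ℕ) : Finset (ℕ × ℕ) :=
  (Finset.Ico N (2 * N) ×ˢ Finset.Ico M (2 * M)).filter
    fun p => p.1 * (p.1 + 1) + p.2 * (p.2 + 1) = k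

theorem card_resonantPairs_le_gaussian (N M k : ℕ) :
    (resonantPairs N M k).card ≤ (gaussianOfNorm (4 * k + 2 : ℕ)).card := by
  refine Finset.card_le_card_of_injOn
    (fun p => (⟨2 * p.1 + 1, 2 * p.2 + 1⟩ : GaussianInt)) ?_ ?_
  · rintro ⟨n, m⟩ hp
    simp only [resonantPairs, Finset.coe_filter, Set.mem_ofPred_eq] at hp
    simp only [Finset.mem_coe, mem_gaussianOfNorm, Zsqrtd.norm]
    rw [← hp.2]; push_cast; ring
  · rintro ⟨n, m⟩ _ ⟨n', m'⟩ _ h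
    simp only [Zsqrtd.mk.injEq] at h
    ext <;> simp <;> omega

/-- Raising `n` increases `n(n+1)` by at least `2(N+1) > 4M²`, while `m(m+1)` stays in `[0, 4M²]`.
So `n` is determined by `k`, and then so is `m`. -/
theorem card_resonantPairs_le_one {N M : ℕ} (h : 2 * M ^ 2 ≤ N) (k : ℕ) :
    (resonantPairs N M k).card ≤ 1 := by
  have key : ∀ n m n' m' : ℕ, N ≤ n → m < 2 * M → m' < 2 * M →
      n * (n + 1) + m * (m + 1) = n' * (n' + 1) + m' * (m' + 1) → ¬ n < n' := by
    intro n m n' m' hn hm hm' he hlt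
    have h1 : (n + 1) * (n + 2) ≤ n' * (n' + 1) := Nat.mul_le_mul hlt (by omega)
    have h2 : m * (m + 1) ≤ (2 * M) * (2 * M) := Nat.mul_le_mul hm.le hm
    nlinarith
  refine Finset.card_le_one.mpr ?_
  rintro ⟨n, m⟩ h1 ⟨n', m'⟩ h2
  simp only [resonantPairs, Finset.mem_filter, Finset.mem_product, Finset.mem_Ico] at h1 h2
  have he := h1.2.trans h2.2.symm
  have hnn : n = n' := le_antisymm
    (not_lt.mp (key n' m' n m h2.1.1.1 h2.1.2.2 h1.1.2.2 he.symm))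
    (not_lt.mp (key n m n' m' h1.1.1.1 h1.1.2.2 h2.1.2.2 he))
  subst hnn
  have hmm : m = m' := by
    have : m * (m + 1) = m' * (m' + 1) := by omega
    rcases lt_trichotomy m m' with h | h | h <;> nlinarith
  rw [hmm]

theorem exists_card_resonantPairs_le {ε : ℝ} (hε : 0 < ε) :
    ∃ C : ℝ, 0 < C ∧ ∀ N M k : ℕ, 1 ≤ M → ((resonantPairs N M k).card : ℝ) ≤ C * (M : ℝ) ^ ε := by
  -- The exponent `ε / 4` compensates for `4k + 2 ≤ 80 M⁴` when `N < 2M²`; the `+ 1` in the constant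
  -- serves the other regime.
  obtain ⟨C, hC, hdiv⟩ := exists_card_divisors_le_rpow (ε := ε / 4) (by positivity)
  refine ⟨4 * C * 80 ^ (ε / 4) + 1, by positivity, fun N M k hM => ?_⟩
  have hM1 : (1 : ℝ) ≤ M := by exact_mod_cast hM
  have hMε : 1 ≤ (M : ℝ) ^ ε := Real.one_le_rpow hM1 hε.le
  have hpos : 0 ≤ 4 * C * 80 ^ (ε / 4) := by positivity
  by_cases h : 2 * M ^ 2 ≤ N
  · have h1 : ((resonantPairs N M k).card : ℝ) ≤ 1 := by
      exact_mod_cast card_resonantPairs_le_one h k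
    nlinarith
  · rcases (resonantPairs N M k).eq_empty_or_nonempty with he | ⟨⟨n, m⟩, hnm⟩
    · rw [he, Finset.card_empty, Nat.cast_zero]; positivity
    simp only [resonantPairs, Finset.mem_filter, Finset.mem_product, Finset.mem_Ico] at hnm
    obtain ⟨⟨⟨-, hn⟩, -, hm⟩, hk⟩ := hnm
    have hk4 : 4 * k + 2 ≤ 80 * M ^ 4 := by
      have e1 : (2 * n + 1) ≤ 8 * M ^ 2 := by omega
      have e2 : (2 * m + 1) ≤ 4 * M := by omega
      have e3 := Nat.mul_le_mul e1 e1
      have e4 := Nat.mul_le_mul e2 e2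
      have e5 : M ^ 2 ≤ M ^ 4 := Nat.pow_le_pow_right hM (by norm_num)
      rw [← hk]; nlinarith
    calc ((resonantPairs N M k).card : ℝ) ≤ (4 * (4 * k + 2).divisors.card : ℕ) := by
          exact_mod_cast (card_resonantPairs_le_gaussian N M k).trans
            (card_gaussianOfNorm_le _ (by omega))
      _ ≤ 4 * (C * ((4 * k + 2 : ℕ) : ℝ) ^ (ε / 4)) := by
          push_cast
          have := hdiv (4 * k + 2) (by omega)
          push_cast at this
          linarith
      _ ≤ 4 * (C * (80 * (M : ℝ) ^ 4) ^ (ε / 4)) := by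
          gcongr
          exact_mod_cast hk4
      _ = 4 * C * 80 ^ (ε / 4) * (M : ℝ) ^ ε := by
          rw [Real.mul_rpow (by norm_num) (by positivity), ← Real.rpow_natCast (M : ℝ) 4,
            ← Real.rpow_mul (by positivity)]
          push_cast
          rw [show (4 : ℝ) * (ε / 4) = ε by ring]; ring
      _ ≤ _ := by nlinarith

/-! ### Legendre polynomials: values at the endpoints, differential equation, orthogonality. -/

open Polynomial in
theorem iterate_derivative_succ_X_mul (p : ℝ[X]) (k : ℕ) :
    derivative^[k + 1] (X * p) = X * derivative^[k + 1] p + (k + 1 : ℝ[X]) * derivative^[k] p := by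
  induction k with
  | zero => simp; ring
  | succ k ih =>
    rw [Function.iterate_succ_apply', ih]
    simp only [derivative_add, derivative_mul, derivative_X, derivative_one, derivative_natCast,
      ← Function.iterate_succ_apply']
    push_cast; ring

open Polynomial in
theorem iterate_derivative_X_sq_sub_one_mul (p : ℝ[X]) (k : ℕ) :
    derivative^[k + 2] ((X ^ 2 - 1) * p) = (X ^ 2 - 1) * derivative^[k + 2] p +
      2 * ((k : ℝ[X]) + 2) * X * derivative^[k + 1] p +
      ((k : ℝ[X]) + 2) * ((k : ℝ[X]) + 1) * derivative^[k] p := by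
  have h : (X ^ 2 - 1) * p = X * (X * p) - p := by ring
  rw [h, iterate_derivative_sub, iterate_derivative_succ_X_mul, iterate_derivative_succ_X_mul,
    iterate_derivative_succ_X_mul]
  push_cast; ring

-- By Leibniz, a term survives at `a` only if all `n` derivatives fall on the power.
open Polynomial in
theorem eval_iterate_derivative_X_sub_C_pow_mul (a : ℝ) (n : ℕ) (q : ℝ[X]) :
    (derivative^[n] ((X - C a) ^ n * q)).eval a = n.factorial * q.eval a := by
  induction n generalizing q with
  | zero => simp
  | succ n ih =>
    have h : derivative ((X - C a) ^ (n + 1) * q) =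
        (X - C a) ^ n * (((n + 1 : ℕ) : ℝ[X]) * q + (X - C a) * derivative q) := by
      rw [derivative_mul, derivative_pow_succ]; simp; ring
    rw [Function.iterate_succ_apply, h, ih]
    simp [Nat.factorial_succ]; ring

theorem legendre_eval_one (n : ℕ) : (legendre n).eval 1 = 1 := by
  have h : ((Polynomial.X : Polynomial ℝ) ^ 2 - 1) ^ n =
      (Polynomial.X - Polynomial.C 1) ^ n * (Polynomial.X + 1) ^ n := by
    rw [← mul_pow]; congr 1; simp; ring
  rw [legendre, Polynomial.eval_mul, h, eval_iterate_derivative_X_sub_C_pow_mul]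
  simp
  have : (n.factorial : ℝ) ≠ 0 := by positivity
  rw [show (1 : ℝ) + 1 = 2 by norm_num]
  field_simp

theorem legendre_eval_neg_one_sq (n : ℕ) : (legendre n).eval (-1) ^ 2 = 1 := by
  have h : ((Polynomial.X : Polynomial ℝ) ^ 2 - 1) ^ n =
      (Polynomial.X - Polynomial.C (-1)) ^ n * (Polynomial.X - 1) ^ n := by
    rw [← mul_pow]; congr 1; simp; ring
  rw [legendre, Polynomial.eval_mul, h, eval_iterate_derivative_X_sub_C_pow_mul]
  simp
  have : (n.factorial : ℝ) ≠ 0 := by positivity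
  have h2 : (-2 : ℝ) ^ n = (-1) ^ n * 2 ^ n := by rw [← mul_pow]; norm_num
  rw [show (-1 : ℝ) - 1 = -2 by norm_num, h2]
  field_simp
  exact neg_one_pow_eq_or ℝ n

open Polynomial in
theorem legendre_ode (n : ℕ) :
    (X ^ 2 - 1) * derivative (derivative (legendre n)) + 2 * X * derivative (legendre n) =
      ((n : ℝ[X]) * ((n : ℝ[X]) + 1)) * legendre n := by
  have key : (X ^ 2 - 1) * derivative^[n + 2] (((X : ℝ[X]) ^ 2 - 1) ^ n) +
      2 * X * derivative^[n + 1] ((X ^ 2 - 1) ^ n) =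
      ((n : ℝ[X]) * ((n : ℝ[X]) + 1)) * derivative^[n] ((X ^ 2 - 1) ^ n) := by
    rcases n with _ | k
    · simp [derivative_one]
    -- With `n = k + 1` and `u = (x²-1)^n`, the first-order equation `(x²-1)u' = 2n x u` is
    -- differentiated `n + 1` times.
    · have h : (X ^ 2 - 1) * derivative (((X : ℝ[X]) ^ 2 - 1) ^ (k + 1)) =
          C (2 * (k + 1) : ℝ) * (X * (X ^ 2 - 1) ^ (k + 1)) := by
        rw [derivative_pow_succ]; simp [show (C 2 : ℝ[X]) = 2 from rfl]; ring
      have h2 := congrArg (derivative^[k + 2]) h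
      rw [iterate_derivative_X_sq_sub_one_mul, iterate_derivative_C_mul,
        iterate_derivative_succ_X_mul] at h2
      simp only [← Function.iterate_succ_apply] at h2
      simp only [C_mul, C_add, map_natCast, C_1, show (C 2 : ℝ[X]) = 2 from rfl] at h2
      push_cast at h2 ⊢
      linear_combination h2
  rw [legendre]
  simp only [derivative_C_mul, ← Function.iterate_succ_apply']
  linear_combination C (((2 : ℝ) ^ n * (n.factorial : ℝ))⁻¹) * key

theorem natDegree_legendre_le (n : ℕ) : (legendre n).natDegree ≤ n := by
  refine (Polynomial.natDegree_C_mul_le _ _).trans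
    ((Polynomial.natDegree_iterate_derivative _ _).trans ?_)
  have : (((Polynomial.X : Polynomial ℝ) ^ 2 - 1) ^ n).natDegree ≤ n * 2 :=
    Polynomial.natDegree_pow_le_of_le n (by compute_degree)
  omega

/-- Integration of polynomials over `[-1, 1]`. -/
noncomputable def polyIntegral : Polynomial ℝ →ₗ[ℝ] ℝ where
  toFun p := ∫ x in (-1 : ℝ)..1, p.eval x
  map_add' p q := by
    simp only [Polynomial.eval_add]
    exact intervalIntegral.integral_add (p.continuous.intervalIntegrable _ _)
      (q.continuous.intervalIntegrable _ _)
  map_smul' c p := by simp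

theorem polyIntegral_apply (p : Polynomial ℝ) : polyIntegral p = ∫ x in (-1 : ℝ)..1, p.eval x := rfl

theorem polyIntegral_derivative (p : Polynomial ℝ) :
    polyIntegral (Polynomial.derivative p) = p.eval 1 - p.eval (-1) :=
  intervalIntegral.integral_eq_sub_of_hasDerivAt (fun x _ => p.hasDerivAt x)
    (p.derivative.continuous.intervalIntegrable _ _)

theorem polyIntegral_C_mul (c : ℝ) (p : Polynomial ℝ) :
    polyIntegral (Polynomial.C c * p) = c * polyIntegral p := by
  rw [← Polynomial.smul_eq_C_mul, map_smul, smul_eq_mul]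

-- Self-adjointness of `L p = ((1-x²)p')'` on `[-1, 1]`, together with `L xᵏ = k(k-1)xᵏ⁻² -
-- k(k+1)xᵏ`, reduces exponent `k` to `k - 2`. The factor `k(k(+1) - n(n+1)` multiplying the
-- integral is nonzero since `k < n`; for `k < 2` the truncated exponent is harmless because `k(k-1)
-- = 0`.
open Polynomial in
theorem polyIntegral_legendre_mul_X_pow {n k : ℕ} (hk : k < n) :
    polyIntegral (legendre n * X ^ k) = 0 := by
  induction k using Nat.strong_induction_on with
  | _ k ih =>
    have h1 := polyIntegral_derivative ((1 - X ^ 2) *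
      (derivative (legendre n) * X ^ k - legendre n * derivative (X ^ k)))
    have hode := legendre_ode n
    have h2 : derivative ((1 - X ^ 2) *
        (derivative (legendre n) * X ^ k - legendre n * derivative (X ^ k))) =
        C ((k : ℝ) * (k + 1) - n * (n + 1)) * (legendre n * X ^ k) -
          C ((k : ℝ) * (k - 1)) * (legendre n * X ^ (k - 2)) := by
      rcases k with _ | _ | k
      · simp; linear_combination -hode
      · simp; linear_combination -X * hode
      · simp
        simp only [show k + 1 + 1 = k + 2 from rfl, pow_succ]
        simp
        linear_combination -X ^ (k + 2) * hode
    rw [h2, map_sub, polyIntegral_C_mul, polyIntegral_C_mul] at h1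
    have h3 : (k : ℝ) * (k - 1) * polyIntegral (legendre n * X ^ (k - 2)) = 0 := by
      rcases k with _ | _ | k
      · simp
      · simp
      · rw [ih _ (by omega) (by omega)]; simp
    rw [h3] at h1
    simp at h1
    rcases h1 with h1 | h1
    · exfalso
      have : (k : ℝ) < n := by exact_mod_cast hk
      nlinarith [(Nat.cast_nonneg k : (0 : ℝ) ≤ k)]
    · exact h1

-- The condition is put on coefficients rather than on `natDegree` so that it also covers `n = 0`,
-- `r = 0`.
open Polynomial in
theorem polyIntegral_legendre_mul {n : ℕ} {r : ℝ[X]} (hr : ∀ k, n ≤ k → r.coeff k = 0) :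
    polyIntegral (legendre n * r) = 0 := by
  rw [r.as_sum_support_C_mul_X_pow, Finset.mul_sum, map_sum]
  refine Finset.sum_eq_zero fun k hk => ?_
  have hkn : k < n := by
    by_contra h
    exact (mem_support_iff.mp hk) (hr k (not_lt.mp h))
  rw [mul_left_comm, polyIntegral_C_mul, polyIntegral_legendre_mul_X_pow hkn, mul_zero]

open Polynomial in
theorem polyIntegral_legendre_sq (n : ℕ) :
    polyIntegral (legendre n ^ 2) = 2 / (2 * n + 1) := by
  have h1 := polyIntegral_derivative (X * legendre n ^ 2)
  -- In `x Pₙ' - n Pₙ` the terms of degree `n` cancel, so it is orthogonal to `Pₙ`; the boundary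
  -- values `Pₙ(±1)² = 1` give the rest.
  have h2 : derivative (X * legendre n ^ 2) = C (2 * n + 1 : ℝ) * legendre n ^ 2 +
      C 2 * (legendre n * (X * derivative (legendre n) - C (n : ℝ) * legendre n)) := by
    simp [derivative_pow, show (C 2 : ℝ[X]) = 2 from rfl]; ring
  have h3 : polyIntegral (legendre n * (X * derivative (legendre n) - C (n : ℝ) * legendre n)) =
      0 := by
    refine polyIntegral_legendre_mul fun k hk => ?_
    rcases k with _ | k
    · have : n = 0 := by omega
      subst this; simp
    · rw [coeff_sub, coeff_X_mul, coeff_C_mul, coeff_derivative]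
      rcases hk.eq_or_lt with h | h
      · rw [h]; push_cast; ring
      · rw [coeff_eq_zero_of_natDegree_lt ((natDegree_legendre_le n).trans_lt h)]; ring
  rw [h2, map_add, polyIntegral_C_mul, polyIntegral_C_mul, h3] at h1
  simp [legendre_eval_one, legendre_eval_neg_one_sq] at h1
  have : (2 * n + 1 : ℝ) ≠ 0 := by positivity
  field_simp
  linarith

/-! ### Energy monotonicity and Bernstein's inequality. -/

theorem le_zero_of_hasDerivAt_neg_mul {f g : ℝ → ℝ}
    (hf : ∀ x ∈ Set.Ioo (-1 : ℝ) 1, HasDerivAt f (-(x * g x)) x)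
    (hg : ∀ x ∈ Set.Ioo (-1 : ℝ) 1, 0 ≤ g x) {x : ℝ} (hx : x ∈ Set.Ioo (-1 : ℝ) 1) :
    f x ≤ f 0 := by
  rcases le_total 0 x with h | h
  · have hsub : Set.Icc 0 x ⊆ Set.Ioo (-1 : ℝ) 1 := fun y hy =>
      ⟨by linarith [hy.1], hy.2.trans_lt hx.2⟩
    refine antitoneOn_of_deriv_nonpos (convex_Icc 0 x)
      (fun y hy => (hf y (hsub hy)).continuousAt.continuousWithinAt)
      (fun y hy => (hf y (hsub (interior_subset hy))).differentiableAt.differentiableWithinAt)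
      (fun y hy => ?_) (Set.left_mem_Icc.mpr h) (Set.right_mem_Icc.mpr h) h
    have hy' := interior_subset hy
    rw [(hf y (hsub hy')).deriv]
    linarith [mul_nonneg hy'.1 (hg y (hsub hy'))]
  · have hsub : Set.Icc x 0 ⊆ Set.Ioo (-1 : ℝ) 1 := fun y hy =>
      ⟨hx.1.trans_le hy.1, by linarith [hy.2]⟩
    refine monotoneOn_of_deriv_nonneg (convex_Icc x 0)
      (fun y hy => (hf y (hsub hy)).continuousAt.continuousWithinAt)
      (fun y hy => (hf y (hsub (interior_subset hy))).differentiableAt.differentiableWithinAt)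
      (fun y hy => ?_) (Set.left_mem_Icc.mpr h) (Set.right_mem_Icc.mpr h) h
    have hy' := interior_subset hy
    rw [(hf y (hsub hy')).deriv]
    nlinarith [hg y (hsub hy'), hy'.2]

open Polynomial in
/-- The energy `P² + (1 - x²) P'² / (n (n + 1))` of the Legendre equation. -/
noncomputable def legendreEnergy (n : ℕ) : ℝ[X] :=
  legendre n ^ 2 + C ((n * (n + 1) : ℝ)⁻¹) * ((1 - X ^ 2) * derivative (legendre n) ^ 2)

open Polynomial in
theorem derivative_legendreEnergy {n : ℕ} (hn : n ≠ 0) :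
    derivative (legendreEnergy n) =
      C ((n * (n + 1) : ℝ)⁻¹) * (2 * X * derivative (legendre n) ^ 2) := by
  have h : C ((n * (n + 1) : ℝ)⁻¹) * ((n : ℝ[X]) * ((n : ℝ[X]) + 1)) = 1 := by
    have : (n * (n + 1) : ℝ) ≠ 0 := by positivity
    rw [← map_natCast C n, ← C_1, ← C_add, ← C_mul, ← C_mul, inv_mul_cancel₀ this]
  have hode := legendre_ode n
  rw [legendreEnergy]
  simp [derivative_pow, show (C 2 : ℝ[X]) = 2 from rfl]
  simp at h
  linear_combination (-2 * C ((n : ℝ) + 1)⁻¹ * C (n : ℝ)⁻¹ * derivative (legendre n)) * hode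
    - 2 * legendre n * derivative (legendre n) * h

theorem legendre_eval_sq_le_legendreEnergy_eval (n : ℕ) {x : ℝ} (hx : x ∈ Set.Icc (-1 : ℝ) 1) :
    (legendre n).eval x ^ 2 ≤ (legendreEnergy n).eval x := by
  have h : 0 ≤ 1 - x ^ 2 := by nlinarith [hx.1, hx.2]
  simp only [legendreEnergy, Polynomial.eval_add, Polynomial.eval_pow, Polynomial.eval_mul,
    Polynomial.eval_sub, Polynomial.eval_C, Polynomial.eval_one, Polynomial.eval_X]
  have : 0 ≤ (n * (n + 1) : ℝ)⁻¹ *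
    ((1 - x ^ 2) * (Polynomial.derivative (legendre n)).eval x ^ 2) := by positivity
  linarith

/-- The energy dominates `Pₙ²`, grows away from `0`, and equals `1` at `±1`. -/
theorem legendre_eval_sq_le_one {n : ℕ} (hn : n ≠ 0) {x : ℝ} (hx : x ∈ Set.Icc (-1 : ℝ) 1) :
    (legendre n).eval x ^ 2 ≤ 1 := by
  refine (legendre_eval_sq_le_legendreEnergy_eval n hx).trans ?_
  have hd : ∀ y : ℝ, deriv (fun z => (legendreEnergy n).eval z) y =
      (n * (n + 1) : ℝ)⁻¹ * (2 * y * (Polynomial.derivative (legendre n)).eval y ^ 2) := by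
    intro y
    rw [Polynomial.deriv, derivative_legendreEnergy hn]; simp
  rcases le_total 0 x with h | h
  · have := monotoneOn_of_deriv_nonneg (convex_Icc (0 : ℝ) 1)
      (legendreEnergy n).continuous.continuousOn (legendreEnergy n).differentiable.differentiableOn
      (fun y hy => by
        have := (interior_subset hy).1
        rw [hd]; positivity) ⟨h, hx.2⟩ (Set.right_mem_Icc.mpr zero_le_one) hx.2
    refine this.trans_eq ?_
    simp [legendreEnergy, legendre_eval_one]
  · have := antitoneOn_of_deriv_nonpos (convex_Icc (-1 : ℝ) 0)
      (legendreEnergy n).continuous.continuousOn (legendreEnergy n).differentiable.differentiableOn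
      (fun y hy => by
        have h1 := (interior_subset hy).2
        rw [hd]
        refine mul_nonpos_of_nonneg_of_nonpos (by positivity)
          (mul_nonpos_of_nonpos_of_nonneg (by linarith) (by positivity)))
      (Set.left_mem_Icc.mpr (by norm_num)) ⟨hx.1, h⟩ hx.1
    refine this.trans_eq ?_
    simp [legendreEnergy, legendre_eval_neg_one_sq]

-- Integration by parts gives `∫ (1-x²) Pₙ'² = n(n+1) ∫ Pₙ²`, so both halves of the energy have the
-- same integral.
open Polynomial in
theorem polyIntegral_legendreEnergy {n : ℕ} (hn : n ≠ 0) :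
    polyIntegral (legendreEnergy n) = 4 / (2 * n + 1) := by
  have hc : (n * (n + 1) : ℝ) ≠ 0 := by positivity
  have h1 := polyIntegral_derivative ((1 - X ^ 2) * (derivative (legendre n) * legendre n))
  have h2 : derivative ((1 - X ^ 2) * (derivative (legendre n) * legendre n)) =
      (1 - X ^ 2) * derivative (legendre n) ^ 2 - C (n * (n + 1) : ℝ) * legendre n ^ 2 := by
    simp [derivative_pow, show (C 2 : ℝ[X]) = 2 from rfl]
    linear_combination -legendre n * legendre_ode n
  rw [h2, map_sub, polyIntegral_C_mul, polyIntegral_legendre_sq] at h1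
  simp only [eval_mul, eval_sub, eval_one, eval_pow, eval_X] at h1
  rw [legendreEnergy, map_add, polyIntegral_C_mul, polyIntegral_legendre_sq]
  have h3 : polyIntegral ((1 - X ^ 2) * derivative (legendre n) ^ 2) =
      n * (n + 1) * (2 / (2 * n + 1)) := by linarith
  rw [h3, inv_mul_cancel_left₀ hc]; ring

/-- The energy is smallest at the equator, hence there at most its average over `[-1, 1]`. This
yields the sharp constant without evaluating `Pₙ(0)` or `Pₙ'(0)`. -/
theorem legendreEnergy_eval_zero_le {n : ℕ} (hn : n ≠ 0) :
    (legendreEnergy n).eval 0 ≤ 2 / (2 * n + 1) := by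
  have h : ∀ x ∈ Set.Ioo (-1 : ℝ) 1, (legendreEnergy n).eval 0 ≤ (legendreEnergy n).eval x := by
    intro x hx
    have := le_zero_of_hasDerivAt_neg_mul (f := fun x => -(legendreEnergy n).eval x)
      (g := fun x => 2 * (n * (n + 1) : ℝ)⁻¹ * (Polynomial.derivative (legendre n)).eval x ^ 2)
      (fun x _ => by
        convert! ((legendreEnergy n).hasDerivAt x).neg using 1
        rw [derivative_legendreEnergy hn]; simp; ring)
      (fun x _ => by positivity) hx
    linarith
  have h2 := intervalIntegral.integral_mono_on_of_le_Ioo (by norm_num)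
    (intervalIntegrable_const (μ := volume)) ((legendreEnergy n).continuous.intervalIntegrable _ _) h
  rw [← polyIntegral_apply, polyIntegral_legendreEnergy hn, intervalIntegral.integral_const] at h2
  have : (4 : ℝ) / (2 * n + 1) = 2 * (2 / (2 * n + 1)) := by ring
  rw [this] at h2
  norm_num at h2 ⊢
  linarith

/-- Bernstein's inequality `√(1 - x²) Pₙ(x)² ≤ 2 / (2 n + 1)`. -/
theorem sqrt_mul_legendre_eval_sq_le {n : ℕ} (hn : n ≠ 0) {x : ℝ} (hx : x ∈ Set.Ioo (-1 : ℝ) 1) :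
    √(1 - x ^ 2) * (legendre n).eval x ^ 2 ≤ 2 / (2 * n + 1) := by
  set P : ℝ → ℝ := fun x => (legendre n).eval x with hP
  set Q : ℝ → ℝ := fun x => (Polynomial.derivative (legendre n)).eval x with hQ
  set R : ℝ → ℝ := fun x =>
    (Polynomial.derivative (Polynomial.derivative (legendre n))).eval x with hR
  set l : ℝ := n * (n + 1) with hl
  have hl0 : 0 < l := by positivity
  have hode : ∀ x, (x ^ 2 - 1) * R x + 2 * x * Q x = l * P x := by
    intro x
    have := congrArg (Polynomial.eval x) (legendre_ode n)
    simpa using this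
  have dP : ∀ x, HasDerivAt P (Q x) x := fun x => (legendre n).hasDerivAt x
  have dQ : ∀ x, HasDerivAt Q (R x) x := fun x => (Polynomial.derivative (legendre n)).hasDerivAt x
  -- Sonin's function: `u = (sin θ)^(1/2) Pₙ(cos θ)` solves `u'' + φ u = 0` with `φ = (n + 1/2)² +
  -- 1/(4 sin² θ)`. In the variable `x = cos θ`, `u' = A / (2 (sin θ)^(1/2))` and `φ = D / (4 sin²
  -- θ)`, so `u² + u'²/φ` is the function `f` of `key`. As `φ` is smallest at the equator, `f` is
  -- largest there.
  set A : ℝ → ℝ := fun x => x * P x - 2 * (1 - x ^ 2) * Q x with hA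
  set D : ℝ → ℝ := fun x => (4 * l + 1) * (1 - x ^ 2) + 1 with hD
  have dsq : ∀ x : ℝ, HasDerivAt (fun y : ℝ => 1 - y ^ 2) (-(2 * x)) x := by
    intro x
    simpa using (hasDerivAt_pow 2 x).const_sub 1
  have dA : ∀ x, HasDerivAt A ((1 + 2 * l) * P x + x * Q x) x := by
    intro x
    convert! ((hasDerivAt_id x).mul (dP x)).sub (((dsq x).const_mul 2).mul (dQ x)) using 1
    simp
    linear_combination -2 * hode x
  have dD : ∀ x, HasDerivAt D ((4 * l + 1) * (-(2 * x))) x := fun x =>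
    ((dsq x).const_mul (4 * l + 1)).add_const 1
  have hpos : ∀ x ∈ Set.Ioo (-1 : ℝ) 1, 0 < 1 - x ^ 2 := fun x hx => by nlinarith [hx.1, hx.2]
  have hDpos : ∀ x ∈ Set.Ioo (-1 : ℝ) 1, 0 < D x := fun x hx => by
    have := hpos x hx
    simp only [hD]; positivity
  have key := le_zero_of_hasDerivAt_neg_mul
    (f := fun x => √(1 - x ^ 2) * (P x ^ 2 + A x ^ 2 / D x))
    (g := fun x => 2 * A x ^ 2 / (√(1 - x ^ 2) * D x ^ 2))
    (fun x hx => by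
      have h1 := hpos x hx
      have h2 := hDpos x hx
      have hs : 0 < √(1 - x ^ 2) := Real.sqrt_pos.mpr h1
      have hs2 : √(1 - x ^ 2) ^ 2 = 1 - x ^ 2 := Real.sq_sqrt h1.le
      convert! ((dsq x).sqrt h1.ne').mul
        (((dP x).pow 2).add (((dA x).pow 2).div (dD x) h2.ne')) using 1
      simp only [Pi.pow_apply, Pi.add_apply, Pi.div_apply]
      have hDx : D x = (4 * l + 1) * (1 - x ^ 2) + 1 := rfl
      have hAx : A x = x * P x - 2 * (1 - x ^ 2) * Q x := rfl
      set s := √(1 - x ^ 2)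
      field_simp
      rw [hs2]
      rw [hDx, hAx]
      ring)
    (fun x hx => by
      have h1 := hpos x hx
      positivity) hx
  have hA2 : 0 ≤ √(1 - x ^ 2) * (A x ^ 2 / D x) := by
    have := hDpos x hx
    positivity
  -- At the equator the two functionals differ only in the weight of `Pₙ'(0)²`: `4/(4l+2)` against
  -- the larger `1/l`.
  have h0 : √(1 - (0 : ℝ) ^ 2) * (P 0 ^ 2 + A 0 ^ 2 / D 0) ≤ (legendreEnergy n).eval 0 := by
    have e1 : (legendreEnergy n).eval 0 = P 0 ^ 2 + Q 0 ^ 2 / l := by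
      simp only [legendreEnergy, Polynomial.eval_add, Polynomial.eval_pow, Polynomial.eval_mul,
        Polynomial.eval_sub, Polynomial.eval_C, Polynomial.eval_one, Polynomial.eval_X, hP, hQ]
      rw [div_eq_inv_mul, hl]; norm_num
    have e2 : √(1 - (0 : ℝ) ^ 2) * (P 0 ^ 2 + A 0 ^ 2 / D 0) =
        P 0 ^ 2 + 4 * Q 0 ^ 2 / (4 * l + 2) := by
      simp only [hA, hD]
      norm_num
      ring_nf
    rw [e1, e2]
    refine add_le_add_right ?_ _
    rw [div_le_div_iff₀ (by positivity) hl0]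
    nlinarith [sq_nonneg (Q 0)]
  have h3 := legendreEnergy_eval_zero_le hn
  change √(1 - x ^ 2) * P x ^ 2 ≤ _
  have h4 := key.trans h0
  rw [mul_add] at h4
  linarith

/-! ### Integrals of products of squared Legendre polynomials. -/

theorem weighted_legendre_sq_mul_sq_le {δ : ℝ} (hδ : 0 < δ) (hδ1 : δ ≤ 1) {n m : ℕ}
    (hn : n ≠ 0) (hm : m ≠ 0) {x : ℝ} (hx : x ∈ Set.Ioo (-1 : ℝ) 1) :
    (2 * n + 1) * (2 * m + 1) * ((legendre n).eval x ^ 2 * (legendre m).eval x ^ 2) ≤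
      4 * (2 * m + 1 : ℝ) ^ δ * ((1 - x) ^ (δ / 2 - 1) + (1 + x) ^ (δ / 2 - 1)) := by
  have h1 : 0 < 1 - x := by linarith [hx.2]
  have h2 : 0 < 1 + x := by linarith [hx.1]
  have h3 : 0 < 1 - x ^ 2 := by nlinarith
  set s := √(1 - x ^ 2) with hs
  have hspos : 0 < s := Real.sqrt_pos.mpr h3
  have hu : ∀ k : ℕ, k ≠ 0 → (2 * k + 1) * (legendre k).eval x ^ 2 ≤ 2 / s := by
    intro k hk
    have := sqrt_mul_legendre_eval_sq_le hk hx
    rw [le_div_iff₀ (by positivity)] at this ⊢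
    linarith
  set v : ℝ := (2 * m + 1) * (legendre m).eval x ^ 2 with hv
  have hv0 : 0 ≤ v := by positivity
  have hv1 : v ≤ 2 * m + 1 := by
    have := legendre_eval_sq_le_one hm ⟨hx.1.le, hx.2.le⟩
    exact mul_le_of_le_one_right (by positivity) this
  -- Interpolation between `Pₘ² ≤ 1` (weight `δ`) and Bernstein (weight `1 - δ`): the total power of
  -- `1/s` falls to `2 - δ`, which is integrable.
  have hvb : v ≤ (2 * m + 1 : ℝ) ^ δ * (2 / s) ^ (1 - δ) := by
    calc v = v ^ δ * v ^ (1 - δ) := by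
          rw [← Real.rpow_add_of_nonneg hv0 hδ.le (by linarith)]; simp
      _ ≤ _ := mul_le_mul (Real.rpow_le_rpow hv0 hv1 hδ.le)
          (Real.rpow_le_rpow hv0 (hu m hm) (by linarith)) (by positivity) (by positivity)
  have hsrpow : (2 / s) * (2 / s) ^ (1 - δ) ≤ 4 * (1 - x ^ 2) ^ (δ / 2 - 1) := by
    have e1 : (2 / s) * (2 / s) ^ (1 - δ) = (2 / s) ^ (2 - δ) := by
      rw [← Real.rpow_one_add' (by positivity) (by linarith)]; congr 1; ring
    rw [e1, Real.div_rpow (by norm_num) hspos.le, hs, Real.sqrt_eq_rpow, ← Real.rpow_mul h3.le,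
      div_eq_mul_inv, ← Real.rpow_neg h3.le, show -(1 / 2 * (2 - δ)) = δ / 2 - 1 by ring]
    gcongr
    calc (2 : ℝ) ^ (2 - δ) ≤ 2 ^ (2 : ℝ) :=
          Real.rpow_le_rpow_of_exponent_le (by norm_num) (by linarith)
      _ = 4 := by norm_num
  have hfin : (1 - x ^ 2) ^ (δ / 2 - 1) ≤
      (1 - x) ^ (δ / 2 - 1) + (1 + x) ^ (δ / 2 - 1) := by
    rcases le_total 0 x with h | h
    · have := Real.rpow_le_rpow_of_nonpos h1 (show 1 - x ≤ 1 - x ^ 2 by nlinarith)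
        (show δ / 2 - 1 ≤ 0 by linarith)
      linarith [Real.rpow_nonneg h2.le (δ / 2 - 1)]
    · have := Real.rpow_le_rpow_of_nonpos h2 (show 1 + x ≤ 1 - x ^ 2 by nlinarith)
        (show δ / 2 - 1 ≤ 0 by linarith)
      linarith [Real.rpow_nonneg h1.le (δ / 2 - 1)]
  calc (2 * n + 1) * (2 * m + 1) * ((legendre n).eval x ^ 2 * (legendre m).eval x ^ 2)
      = ((2 * n + 1) * (legendre n).eval x ^ 2) * v := by rw [hv]; ring
    _ ≤ (2 / s) * ((2 * m + 1 : ℝ) ^ δ * (2 / s) ^ (1 - δ)) := by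
        gcongr
        exact hu n hn
    _ = (2 * m + 1 : ℝ) ^ δ * ((2 / s) * (2 / s) ^ (1 - δ)) := by ring
    _ ≤ (2 * m + 1 : ℝ) ^ δ *
        (4 * ((1 - x) ^ (δ / 2 - 1) + (1 + x) ^ (δ / 2 - 1))) := by
        refine mul_le_mul_of_nonneg_left (hsrpow.trans ?_) (by positivity)
        gcongr
    _ = _ := by ring

theorem exists_polyIntegral_legendre_sq_mul_sq_le {δ : ℝ} (hδ : 0 < δ) (hδ1 : δ ≤ 1) :
    ∃ C : ℝ, 0 < C ∧ ∀ n m : ℕ, n ≠ 0 → m ≠ 0 →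
      (2 * n + 1) * (2 * m + 1) * polyIntegral (legendre n ^ 2 * legendre m ^ 2) ≤
        C * (2 * m + 1 : ℝ) ^ δ := by
  set w : ℝ → ℝ := fun x => (1 - x) ^ (δ / 2 - 1) + (1 + x) ^ (δ / 2 - 1) with hw
  have hint : IntervalIntegrable w volume (-1) 1 := by
    have h0 : ∀ a b : ℝ, IntervalIntegrable (fun x : ℝ => x ^ (δ / 2 - 1)) volume a b :=
      fun a b => intervalIntegral.intervalIntegrable_rpow' (by linarith)
    refine IntervalIntegrable.add ?_ ?_
    · have := (h0 2 0).comp_sub_left 1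
      norm_num at this
      exact this
    · have := (h0 0 2).comp_add_left 1
      norm_num at this
      exact this
  have hw0 : 0 ≤ ∫ x in (-1 : ℝ)..1, w x := by
    refine intervalIntegral.integral_nonneg (by norm_num) fun x hx => ?_
    exact add_nonneg (Real.rpow_nonneg (by linarith [hx.2]) _)
      (Real.rpow_nonneg (by linarith [hx.1]) _)
  refine ⟨4 * (∫ x in (-1 : ℝ)..1, w x) + 1, by positivity, fun n m hn hm => ?_⟩
  have key := intervalIntegral.integral_mono_on_of_le_Ioo (μ := volume) (a := -1) (b := 1)
    (f := fun x => (2 * n + 1) * (2 * m + 1) * (legendre n ^ 2 * legendre m ^ 2).eval x)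
    (g := fun x => 4 * (2 * m + 1 : ℝ) ^ δ * w x) (by norm_num)
    ((legendre n ^ 2 * legendre m ^ 2).continuous.const_mul _ |>.intervalIntegrable _ _)
    (hint.const_mul _) (fun x hx => by
      simpa [hw] using weighted_legendre_sq_mul_sq_le hδ hδ1 hn hm hx)
  rw [intervalIntegral.integral_const_mul, intervalIntegral.integral_const_mul,
    ← polyIntegral_apply] at key
  have : 0 ≤ (2 * m + 1 : ℝ) ^ δ := by positivity
  linarith

/-! ### Radial extensions and Green's identity on the sphere. -/

theorem radialExtension_coe (φ : S2 → ℂ) (x : S2) : radialExtension φ (x : E3) = φ x := by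
  have hx : ‖(x : E3)‖ = 1 := by simp
  have h0 : (x : E3) ≠ 0 := fun h => by simp [h] at hx
  rw [radialExtension, dif_neg h0]
  congr 1
  ext1
  simp [hx]

theorem radialExtension_smul (φ : S2 → ℂ) {r : ℝ} (hr : 0 < r) (y : E3) :
    radialExtension φ (r • y) = radialExtension φ y := by
  by_cases hy : y = 0
  · simp [hy]
  · rw [radialExtension, radialExtension, dif_neg hy, dif_neg (smul_ne_zero hr.ne' hy)]
    congr 1
    ext1
    simp only [norm_smul, Real.norm_eq_abs, abs_of_pos hr, smul_smul]
    congr 1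
    field_simp

theorem fderiv_radialExtension_smul (φ : S2 → ℂ) {r : ℝ} (hr : 0 < r) (y : E3) :
    fderiv ℝ (radialExtension φ) y = r • fderiv ℝ (radialExtension φ) (r • y) := by
  rw [← fderiv_comp_smul]
  congr 1
  ext z
  exact (radialExtension_smul φ hr z).symm

theorem laplacian_radialExtension_smul (φ : S2 → ℂ) {r : ℝ} (hr : 0 < r) (y : E3) :
    Laplacian.laplacian (radialExtension φ) (r • y) =
      ((r ^ 2)⁻¹ : ℝ) • Laplacian.laplacian (radialExtension φ) y := by
  have h : fderiv ℝ (fderiv ℝ (radialExtension φ)) y =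
      r ^ 2 • fderiv ℝ (fderiv ℝ (radialExtension φ)) (r • y) := by
    have h1 : fderiv ℝ (radialExtension φ) =
        r • fun z => fderiv ℝ (radialExtension φ) (r • z) :=
      funext fun z => fderiv_radialExtension_smul φ hr z
    conv_lhs => rw [h1]
    have h2 := congrFun (fderiv_const_smul_field (𝕜 := ℝ) (E := E3) (F := E3 →L[ℝ] ℂ)
      (f := fun z => fderiv ℝ (radialExtension φ) (r • z)) r) y
    rw [h2, Pi.smul_apply, fderiv_comp_smul, smul_smul, sq]
  rw [InnerProductSpace.laplacian_eq_iteratedFDeriv_orthonormalBasis _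
    (EuclideanSpace.basisFun (Fin 3) ℝ)]
  simp only [iteratedFDeriv_two_apply]
  rw [Finset.smul_sum]
  refine Finset.sum_congr rfl fun i _ => ?_
  rw [h]
  simp only [smul_apply, smul_smul]
  rw [inv_mul_cancel₀ (by positivity), one_smul]

theorem SmoothOnS2.contDiffAt {φ : S2 → ℂ} (hφ : SmoothOnS2 φ) {y : E3} (hy : y ≠ 0) :
    ContDiffAt ℝ ∞ (radialExtension φ) y :=
  ContDiffOn.contDiffAt hφ (isOpen_compl_singleton.mem_nhds hy)

theorem SmoothOnS2.contDiffAt_fderiv_apply {φ : S2 → ℂ} (hφ : SmoothOnS2 φ) {y : E3} (hy : y ≠ 0)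
    (v : E3) : ContDiffAt ℝ 1 (fun z => fderiv ℝ (radialExtension φ) z v) y :=
  ((hφ.contDiffAt hy).fderiv_right (m := 1) (by norm_cast)).clm_apply contDiffAt_const

theorem SmoothOnS2.fderiv_apply_self {φ : S2 → ℂ} (hφ : SmoothOnS2 φ) {y : E3} (hy : y ≠ 0) :
    fderiv ℝ (radialExtension φ) y y = 0 := by
  have h1 : HasDerivAt (fun t : ℝ => t • y) y 1 := by
    simpa using (hasDerivAt_id (1 : ℝ)).smul_const y
  have h2 : HasFDerivAt (radialExtension φ) (fderiv ℝ (radialExtension φ) y) ((1 : ℝ) • y) := by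
    rw [one_smul]
    exact ((hφ.contDiffAt hy).differentiableAt (by simp)).hasFDerivAt
  have h3 := h2.comp_hasDerivAt 1 h1
  have h4 : (radialExtension φ ∘ fun t : ℝ => t • y) =ᶠ[nhds 1]
      fun _ => radialExtension φ y := by
    filter_upwards [lt_mem_nhds zero_lt_one] with t ht
    exact radialExtension_smul φ ht y
  exact h3.unique ((hasDerivAt_const (1 : ℝ) _).congr_of_eventuallyEq h4)

theorem SmoothOnS2.laplacian_eq_sum {φ : S2 → ℂ} (hφ : SmoothOnS2 φ) {y : E3} (hy : y ≠ 0) :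
    Laplacian.laplacian (radialExtension φ) y =
      ∑ i : Fin 3, fderiv ℝ (fun z => fderiv ℝ (radialExtension φ) z
        (EuclideanSpace.basisFun (Fin 3) ℝ i)) y (EuclideanSpace.basisFun (Fin 3) ℝ i) := by
  rw [InnerProductSpace.laplacian_eq_iteratedFDeriv_orthonormalBasis _
    (EuclideanSpace.basisFun (Fin 3) ℝ)]
  simp only [iteratedFDeriv_two_apply]
  refine Finset.sum_congr rfl fun i _ => ?_
  have hd : DifferentiableAt ℝ (fderiv ℝ (radialExtension φ)) y :=
    ((hφ.contDiffAt hy).fderiv_right (m := 1) (by norm_cast)).differentiableAt (by simp)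
  rw [fderiv_clm_apply hd (differentiableAt_const _)]
  simp

/-- A smooth function on the line supported in `[1, 3]`. -/
noncomputable def annulusBump : ContDiffBump (2 : ℝ) := ⟨1 / 2, 1, by norm_num, by norm_num⟩

/-- A smooth radial function on `ℝ³` that is supported in an annulus. -/
noncomputable def annulusCutoff (y : E3) : ℂ := (annulusBump (‖y‖ ^ 2) : ℝ)

theorem contDiff_annulusCutoff : ContDiff ℝ ∞ annulusCutoff :=
  Complex.ofRealCLM.contDiff.comp (annulusBump.contDiff.comp (contDiff_norm_sq ℝ))

theorem annulusCutoff_eventuallyEq_zero : annulusCutoff =ᶠ[nhds 0] 0 := by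
  filter_upwards [Metric.ball_mem_nhds (0 : E3) zero_lt_one] with y hy
  have h : ‖y‖ ^ 2 ≤ 1 := pow_le_one₀ (norm_nonneg _) (by simpa using (mem_ball_zero_iff.mp hy).le)
  simp only [annulusCutoff, Pi.zero_apply, Complex.ofReal_eq_zero]
  refine annulusBump.zero_of_le_dist ?_
  rw [Real.dist_eq, abs_sub_comm]
  exact le_trans (by simp [annulusBump]; linarith) (le_abs_self _)

theorem hasCompactSupport_annulusCutoff : HasCompactSupport annulusCutoff := by
  refine HasCompactSupport.of_support_subset_isCompact (isCompact_closedBall (0 : E3) 2) ?_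
  intro y hy
  by_contra h
  apply hy
  have h1 : 2 < ‖y‖ := by simpa using h
  simp only [annulusCutoff, Complex.ofReal_eq_zero]
  refine annulusBump.zero_of_le_dist ?_
  rw [Real.dist_eq]
  refine le_trans ?_ (le_abs_self _)
  simp [annulusBump]
  nlinarith

theorem exists_fderiv_annulusCutoff (y : E3) :
    ∃ c : ℂ, ∀ v, fderiv ℝ annulusCutoff y v = c * (inner ℝ y v : ℝ) := by
  have hb : HasDerivAt annulusBump (deriv annulusBump (‖y‖ ^ 2)) (‖y‖ ^ 2) :=
    (annulusBump.contDiff (n := 1)).differentiable (by simp) _ |>.hasDerivAt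
  have h : HasFDerivAt annulusCutoff _ y :=
    Complex.ofRealCLM.hasFDerivAt.comp y
      (HasDerivAt.comp_hasFDerivAt (f := fun z : E3 => ‖z‖ ^ 2) (h₂ := annulusBump) y hb
        (hasStrictFDerivAt_norm_sq y).hasFDerivAt)
  refine ⟨2 * (deriv annulusBump (‖y‖ ^ 2) : ℝ), fun v => ?_⟩
  rw [h.fderiv]
  simp
  ring

/-- The `v`-component of Green's vector field for two functions on the sphere. -/
noncomputable def greenField (φ ψ : S2 → ℂ) (v y : E3) : ℂ :=
  annulusCutoff y * (radialExtension ψ y * fderiv ℝ (radialExtension φ) y v -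
    radialExtension φ y * fderiv ℝ (radialExtension ψ) y v)

theorem contDiff_greenField {φ ψ : S2 → ℂ} (hφ : SmoothOnS2 φ) (hψ : SmoothOnS2 ψ) (v : E3) :
    ContDiff ℝ 1 (greenField φ ψ v) := by
  rw [contDiff_iff_contDiffAt]
  intro y
  by_cases hy : y = 0
  · have : greenField φ ψ v =ᶠ[nhds y] fun _ => 0 := by
      rw [hy]
      filter_upwards [annulusCutoff_eventuallyEq_zero] with z hz
      simp [greenField, hz]
    exact contDiffAt_const.congr_of_eventuallyEq this
  · have h1 : ContDiffAt ℝ 1 annulusCutoff y :=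
      (contDiff_annulusCutoff.of_le (by norm_cast)).contDiffAt
    have h2 : ContDiffAt ℝ 1 (radialExtension φ) y := (hφ.contDiffAt hy).of_le (by norm_cast)
    have h3 : ContDiffAt ℝ 1 (radialExtension ψ) y := (hψ.contDiffAt hy).of_le (by norm_cast)
    exact h1.mul ((h3.mul (hφ.contDiffAt_fderiv_apply hy v)).sub
      (h2.mul (hψ.contDiffAt_fderiv_apply hy v)))

theorem hasCompactSupport_greenField (φ ψ : S2 → ℂ) (v : E3) :
    HasCompactSupport (greenField φ ψ v) :=
  hasCompactSupport_annulusCutoff.mul_right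

theorem integral_fderiv_apply_eq_zero {G : E3 → ℂ} (hG : ContDiff ℝ 1 G)
    (hc : HasCompactSupport G) (v : E3) :
    Integrable (fun y => fderiv ℝ G y v) ∧ ∫ y, fderiv ℝ G y v = 0 := by
  have hint : Integrable (fun y => fderiv ℝ G y v) :=
    ((hG.continuous_fderiv (by simp)).clm_apply continuous_const).integrable_of_hasCompactSupport
      (hc.fderiv_apply ℝ v)
  refine ⟨hint, ?_⟩
  have := integral_mul_fderiv_eq_neg_fderiv_mul_of_integrable (μ := (volume : Measure E3))
    (f := fun _ => (1 : ℂ)) (g := G) (v := v) (by simp) (by simpa using hint)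
    (by simpa using hG.continuous.integrable_of_hasCompactSupport hc)
    (fun x _ => differentiableAt_const _) (fun x _ => hG.differentiable (by simp) x)
  simpa using this

/-- The divergence of Green's field has no term from the cutoff: the gradient of the cutoff is
radial, and the radial derivatives of both extensions vanish. The mixed products of first
derivatives cancel by antisymmetry. -/
theorem sum_fderiv_greenField {φ ψ : S2 → ℂ} (hφ : SmoothOnS2 φ) (hψ : SmoothOnS2 ψ) (y : E3) :
    ∑ i : Fin 3, fderiv ℝ (greenField φ ψ (EuclideanSpace.basisFun (Fin 3) ℝ i)) y
        (EuclideanSpace.basisFun (Fin 3) ℝ i) =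
      annulusCutoff y * (radialExtension ψ y * Laplacian.laplacian (radialExtension φ) y -
        radialExtension φ y * Laplacian.laplacian (radialExtension ψ) y) := by
  by_cases hy : y = 0
  · subst hy
    have h0 : ∀ v, greenField φ ψ v =ᶠ[nhds 0] fun _ => 0 := by
      intro v
      filter_upwards [annulusCutoff_eventuallyEq_zero] with z hz
      simp [greenField, hz]
    have h1 : annulusCutoff 0 = 0 := annulusCutoff_eventuallyEq_zero.eq_of_nhds
    simp [h1, (h0 _).fderiv_eq]
  · obtain ⟨c, hc⟩ := exists_fderiv_annulusCutoff y
    have h1 : HasFDerivAt annulusCutoff (fderiv ℝ annulusCutoff y) y :=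
      (contDiff_annulusCutoff.differentiable (by simp) y).hasFDerivAt
    have h2 : HasFDerivAt (radialExtension φ) (fderiv ℝ (radialExtension φ) y) y :=
      ((hφ.contDiffAt hy).differentiableAt (by simp)).hasFDerivAt
    have h3 : HasFDerivAt (radialExtension ψ) (fderiv ℝ (radialExtension ψ) y) y :=
      ((hψ.contDiffAt hy).differentiableAt (by simp)).hasFDerivAt
    have h4 := fun v => ((hφ.contDiffAt_fderiv_apply hy v).differentiableAt (by simp)).hasFDerivAt
    have h5 := fun v => ((hψ.contDiffAt_fderiv_apply hy v).differentiableAt (by simp)).hasFDerivAt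
    have hterm : ∀ v : E3, fderiv ℝ (greenField φ ψ v) y v =
        annulusCutoff y * (radialExtension ψ y *
            fderiv ℝ (fun z => fderiv ℝ (radialExtension φ) z v) y v -
          radialExtension φ y * fderiv ℝ (fun z => fderiv ℝ (radialExtension ψ) z v) y v) +
        c * (radialExtension ψ y * fderiv ℝ (radialExtension φ) y ((inner ℝ y v : ℝ) • v) -
          radialExtension φ y * fderiv ℝ (radialExtension ψ) y ((inner ℝ y v : ℝ) • v)) := by
      intro v
      have h := h1.mul ((h3.mul (h4 v)).sub (h2.mul (h5 v)))
      have h' : HasFDerivAt (greenField φ ψ v) _ y := h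
      rw [h'.fderiv]
      simp [hc]
      ring
    simp only [hterm]
    rw [Finset.sum_add_distrib, ← Finset.mul_sum, ← Finset.mul_sum, Finset.sum_sub_distrib,
      Finset.sum_sub_distrib, ← Finset.mul_sum, ← Finset.mul_sum, ← Finset.mul_sum,
      ← Finset.mul_sum, ← map_sum, ← map_sum, hφ.laplacian_eq_sum hy, hψ.laplacian_eq_sum hy]
    have hsum : ∑ i : Fin 3, (inner ℝ y (EuclideanSpace.basisFun (Fin 3) ℝ i) : ℝ) •
        EuclideanSpace.basisFun (Fin 3) ℝ i = y := by
      simpa only [real_inner_comm] using (EuclideanSpace.basisFun (Fin 3) ℝ).sum_repr' y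
    rw [hsum, hφ.fderiv_apply_self hy, hψ.fderiv_apply_self hy]
    ring

theorem integral_polar (β : ℝ → ℂ) (k : E3 → ℂ) :
    ∫ y : E3, β ‖y‖ * k (‖y‖⁻¹ • y) =
      (∫ x : S2, k x ∂(volume : Measure E3).toSphere) *
        ∫ r in Set.Ioi (0 : ℝ), ((r ^ 2 : ℝ) : ℂ) * β r := by
  have hdim : Module.finrank ℝ E3 - 1 = 2 := by simp
  calc ∫ y : E3, β ‖y‖ * k (‖y‖⁻¹ • y)
      = ∫ y : ({(0)}ᶜ : Set E3), β ‖y.1‖ * k (‖y.1‖⁻¹ • y.1)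
          ∂((volume : Measure E3).comap (↑)) := by
        rw [integral_subtype_comap (measurableSet_singleton _).compl
          fun y : E3 => β ‖y‖ * k (‖y‖⁻¹ • y), restrict_compl_singleton]
    _ = ∫ p : S2 × Set.Ioi (0 : ℝ), k p.1 * β p.2
          ∂(volume : Measure E3).toSphere.prod (.volumeIoiPow 2) := by
        have := (volume : Measure E3).measurePreserving_homeomorphUnitSphereProd.integral_comp
          (Homeomorph.measurableEmbedding _)
          (fun p : S2 × Set.Ioi (0 : ℝ) => k p.1 * β p.2)
        rw [hdim] at this
        rw [← this]
        simp [mul_comm]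
    _ = (∫ x : S2, k x ∂(volume : Measure E3).toSphere) *
          ∫ r : Set.Ioi (0 : ℝ), β r ∂(.volumeIoiPow 2) :=
        integral_prod_mul (fun x : S2 => k x) (fun r : Set.Ioi (0 : ℝ) => β r)
    _ = _ := by
        congr 1
        simp only [Measure.volumeIoiPow, ENNReal.ofReal]
        rw [integral_withDensity_eq_integral_smul,
          integral_subtype_comap measurableSet_Ioi fun a => Real.toNNReal (a ^ 2) • β a]
        · refine setIntegral_congr_fun measurableSet_Ioi fun x hx => ?_
          rw [NNReal.smul_def, Real.coe_toNNReal _ (by positivity), Complex.real_smul]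
        · exact (measurable_subtype_coe.pow_const _).real_toNNReal

theorem integral_annulusBump_ne_zero :
    (∫ r in Set.Ioi (0 : ℝ), ((annulusBump (r ^ 2) : ℝ) : ℂ)) ≠ 0 := by
  rw [integral_complex_ofReal, Complex.ofReal_ne_zero]
  have hcont : Continuous fun r : ℝ => annulusBump (r ^ 2) :=
    annulusBump.continuous.comp (by fun_prop)
  have hcs : HasCompactSupport fun r : ℝ => annulusBump (r ^ 2) := by
    refine HasCompactSupport.of_support_subset_isCompact (isCompact_Icc (a := (-2 : ℝ)) (b := 2)) ?_
    intro r hr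
    by_contra h
    apply hr
    refine annulusBump.zero_of_le_dist ?_
    rw [Real.dist_eq]
    refine le_trans ?_ (le_abs_self _)
    simp [annulusBump]
    simp only [Set.mem_Icc, not_and_or, not_le] at h
    rcases h with h | h <;> nlinarith
  refine ne_of_gt ((setIntegral_pos_iff_support_of_nonneg_ae
    (Filter.Eventually.of_forall fun r => annulusBump.nonneg)
    (hcont.integrable_of_hasCompactSupport hcs).integrableOn).mpr ?_)
  have hopen : IsOpen (Function.support (fun r : ℝ => annulusBump (r ^ 2)) ∩ Set.Ioi 0) :=
    hcont.isOpen_support.inter isOpen_Ioi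
  refine hopen.measure_pos volume ⟨√2, ?_, by simp⟩
  simp only [Function.mem_support]
  rw [Real.sq_sqrt (by norm_num), annulusBump.one_of_mem_closedBall (by simp [annulusBump])]
  exact one_ne_zero

/-- **Green's identity on the sphere.** -/
theorem integral_laplaceBeltrami_comm {φ ψ : S2 → ℂ} (hφ : SmoothOnS2 φ) (hψ : SmoothOnS2 ψ) :
    ∫ x, (ψ x * laplaceBeltrami φ x - φ x * laplaceBeltrami ψ x) ∂sigma = 0 := by
  set k : E3 → ℂ := fun y => radialExtension ψ y * Laplacian.laplacian (radialExtension φ) y -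
    radialExtension φ y * Laplacian.laplacian (radialExtension ψ) y with hk
  have h1 : ∫ y : E3, annulusCutoff y * k y = 0 := by
    simp only [hk, ← sum_fderiv_greenField hφ hψ]
    rw [integral_finsetSum _ fun i _ => (integral_fderiv_apply_eq_zero
      (contDiff_greenField hφ hψ _) (hasCompactSupport_greenField φ ψ _) _).1]
    exact Finset.sum_eq_zero fun i _ => (integral_fderiv_apply_eq_zero
      (contDiff_greenField hφ hψ _) (hasCompactSupport_greenField φ ψ _) _).2
  -- Since `k` is homogeneous of degree `-2`, the integrand is a radial factor times a function on
  -- the sphere. The `r⁻²` then cancels the Jacobian `r²`, leaving a nonzero radial integral to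
  -- divide by.
  have h2 : ∀ y : E3, annulusCutoff y * k y =
      (fun r : ℝ => ((annulusBump (r ^ 2) * (r ^ 2)⁻¹ : ℝ) : ℂ)) ‖y‖ * k (‖y‖⁻¹ • y) := by
    intro y
    by_cases hy : y = 0
    · have h0 : annulusCutoff 0 = 0 := annulusCutoff_eventuallyEq_zero.eq_of_nhds
      simp [hy, h0]
    · have hn : 0 < ‖y‖ := norm_pos_iff.mpr hy
      have hn' : 0 < ‖y‖⁻¹ := inv_pos.mpr hn
      simp only [hk, radialExtension_smul _ hn', laplacian_radialExtension_smul _ hn',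
        annulusCutoff, Complex.real_smul]
      have : (‖y‖ : ℂ) ≠ 0 := by exact_mod_cast hn.ne'
      push_cast
      field_simp
  simp only [h2] at h1
  rw [integral_polar (fun r : ℝ => ((annulusBump (r ^ 2) * (r ^ 2)⁻¹ : ℝ) : ℂ))] at h1
  have h3 : ∫ r in Set.Ioi (0 : ℝ), ((r ^ 2 : ℝ) : ℂ) * ((annulusBump (r ^ 2) * (r ^ 2)⁻¹ : ℝ) : ℂ) =
      ∫ r in Set.Ioi (0 : ℝ), ((annulusBump (r ^ 2) : ℝ) : ℂ) := by
    refine setIntegral_congr_fun measurableSet_Ioi fun r hr => ?_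
    have : (r : ℂ) ≠ 0 := by exact_mod_cast (ne_of_gt hr)
    push_cast
    field_simp
  rw [h3] at h1
  have h4 := (mul_eq_zero.mp h1).resolve_right integral_annulusBump_ne_zero
  rw [sigma, integral_smul_measure]
  simp only [hk, radialExtension_coe] at h4
  simp only [laplaceBeltrami]
  rw [h4, smul_zero]

/-! ### Zonal polynomials and the distribution of the third coordinate. -/

/-- The zonal function on the sphere given by a polynomial in the third coordinate. -/
noncomputable def zonalPoly (p : Polynomial ℝ) (x : S2) : ℂ := ((p.eval ((x : E3) 2) : ℝ) : ℂ)

theorem zonalFun_eq_zonalPoly (n : ℕ) :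
    zonalFun n = zonalPoly (Polynomial.C √(2 * n + 1) * legendre n) := by
  ext x; simp [zonalFun, zonalPoly]

theorem radialExtension_zonalPoly (p : Polynomial ℝ) {y : E3} (hy : y ≠ 0) :
    radialExtension (zonalPoly p) y = ((p.eval (y 2 / ‖y‖) : ℝ) : ℂ) := by
  rw [radialExtension, dif_neg hy]
  simp [zonalPoly, div_eq_inv_mul]

theorem smoothOnS2_zonalPoly (p : Polynomial ℝ) : SmoothOnS2 (zonalPoly p) := by
  have h : ContDiffOn ℝ ∞ (fun y : E3 => ((p.eval (y 2 / ‖y‖) : ℝ) : ℂ)) {0}ᶜ := by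
    intro y hy
    have hy' : y ≠ 0 := hy
    have hp : ContDiff ℝ ∞ fun x : ℝ => p.eval x := by
      simpa only [Polynomial.coe_aeval_eq_eval] using p.contDiff_aeval (𝕜 := ℝ) ∞
    have h2 : ContDiffAt ℝ ∞ (fun y : E3 => y 2) y :=
      (EuclideanSpace.proj (𝕜 := ℝ) (2 : Fin 3)).contDiff.contDiffAt
    exact (Complex.ofRealCLM.contDiff.contDiffAt.comp y (hp.contDiffAt.comp y
      (h2.div (contDiffAt_norm ℝ hy') (norm_ne_zero_iff.mpr hy')))).contDiffWithinAt
  exact h.congr fun y hy => radialExtension_zonalPoly p hy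

theorem hasDerivAt_norm_add_smul {z : E3} (hz : z ≠ 0) (v : E3) :
    HasDerivAt (fun t : ℝ => ‖z + t • v‖) (inner ℝ z v / ‖z‖) 0 := by
  have h1 : HasDerivAt (fun t : ℝ => z + t • v) v 0 := by
    simpa using ((hasDerivAt_id (0 : ℝ)).smul_const v).const_add z
  have h2 := h1.norm_sq
  have h3 := h2.sqrt (by simpa using hz)
  simp only [Real.sqrt_sq (norm_nonneg _)] at h3
  convert! h3 using 1
  simp
  field_simp

theorem fderiv_radialExtension_zonalPoly (p : Polynomial ℝ) {z : E3} (hz : z ≠ 0) (v : E3) :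
    fderiv ℝ (radialExtension (zonalPoly p)) z v =
      (((Polynomial.derivative p).eval (z 2 / ‖z‖) *
        (v 2 / ‖z‖ - z 2 * inner ℝ z v / ‖z‖ ^ 3) : ℝ) : ℂ) := by
  have hn : ‖z‖ ≠ 0 := norm_ne_zero_iff.mpr hz
  have hd : DifferentiableAt ℝ (radialExtension (zonalPoly p)) z :=
    ((smoothOnS2_zonalPoly p).contDiffAt hz).differentiableAt (by simp)
  have hl : HasDerivAt (fun t : ℝ => radialExtension (zonalPoly p) (z + t • v))
    (fderiv ℝ (radialExtension (zonalPoly p)) z v) 0 := hd.hasFDerivAt.hasLineDerivAt v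
  refine hl.unique ?_
  have h1 : HasDerivAt (fun t : ℝ => z 2 + t * v 2) (v 2) 0 := by
    simpa using ((hasDerivAt_id (0 : ℝ)).mul_const (v 2)).const_add (z 2)
  have h2 := h1.div (hasDerivAt_norm_add_smul hz v) (by simpa using hn)
  have h3 := ((p.hasDerivAt _).comp (0 : ℝ) h2).ofReal_comp
  have hev : ∀ᶠ t : ℝ in nhds 0, z + t • v ≠ 0 := by
    have hc : ContinuousAt (fun t : ℝ => z + t • v) 0 := by fun_prop
    exact hc.eventually_ne (by simpa using hz)
  refine (h3.congr_of_eventuallyEq ?_).congr_deriv ?_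
  · filter_upwards [hev] with t ht
    rw [radialExtension_zonalPoly p ht]
    simp
  · simp
    left
    have : (‖z‖ : ℂ) ≠ 0 := by exact_mod_cast hn
    field_simp

theorem fderiv_fderiv_radialExtension_zonalPoly (p : Polynomial ℝ) (x : S2) (v : E3) :
    fderiv ℝ (fun z => fderiv ℝ (radialExtension (zonalPoly p)) z v) (x : E3) v =
      (((Polynomial.derivative (Polynomial.derivative p)).eval ((x : E3) 2) *
          (v 2 - (x : E3) 2 * inner ℝ (x : E3) v) ^ 2 +
        (Polynomial.derivative p).eval ((x : E3) 2) *
          (3 * (x : E3) 2 * inner ℝ (x : E3) v ^ 2 - 2 * (v 2 * inner ℝ (x : E3) v) -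
            (x : E3) 2 * inner ℝ v v) : ℝ) : ℂ) := by
  have hx1 : ‖(x : E3)‖ = 1 := by simp
  set z : E3 := (x : E3) with hzdef
  have hz : z ≠ 0 := fun h => by simp [h] at hx1
  have hd := ((smoothOnS2_zonalPoly p).contDiffAt_fderiv_apply hz v).differentiableAt (by simp)
  have hl : HasDerivAt (fun t : ℝ => fderiv ℝ (radialExtension (zonalPoly p)) (z + t • v) v)
    (fderiv ℝ (fun z => fderiv ℝ (radialExtension (zonalPoly p)) z v) z v) 0 :=
    hd.hasFDerivAt.hasLineDerivAt v
  refine hl.unique ?_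
  have h1 : HasDerivAt (fun t : ℝ => z 2 + t * v 2) (v 2) 0 := by
    simpa using ((hasDerivAt_id (0 : ℝ)).mul_const (v 2)).const_add (z 2)
  have h1' : HasDerivAt (fun t : ℝ => inner ℝ z v + t * inner ℝ v v) (inner ℝ v v : ℝ) 0 := by
    simpa using ((hasDerivAt_id (0 : ℝ)).mul_const (inner ℝ v v : ℝ)).const_add (inner ℝ z v : ℝ)
  have hN := hasDerivAt_norm_add_smul hz v
  have h2 := h1.div hN (by simp [hx1])
  have h3 := ((Polynomial.derivative p).hasDerivAt _).comp (0 : ℝ) h2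
  have h4 := ((hasDerivAt_const (0 : ℝ) (v 2)).div hN (by simp [hx1])).sub
    ((h1.mul h1').div (hN.pow 3) (by simp [hx1]))
  have h5 := (h3.mul h4).ofReal_comp
  have hev : ∀ᶠ t : ℝ in nhds 0, z + t • v ≠ 0 := by
    have hc : ContinuousAt (fun t : ℝ => z + t • v) 0 := by fun_prop
    exact hc.eventually_ne (by simpa using hz)
  refine (h5.congr_of_eventuallyEq ?_).congr_deriv ?_
  · filter_upwards [hev] with t ht
    rw [fderiv_radialExtension_zonalPoly p ht]
    simp [inner_add_left, inner_smul_left]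
  · congr 1
    simp [hx1]
    ring

/-- The sum of the second derivatives of `p(y₃/|y|)` along the standard basis, simplified with `|x|
= 1`, is the Legendre operator. -/
theorem laplaceBeltrami_zonalPoly (p : Polynomial ℝ) :
    laplaceBeltrami (zonalPoly p) = zonalPoly
      (Polynomial.derivative ((1 - Polynomial.X ^ 2) * Polynomial.derivative p)) := by
  ext x
  have hx1 : ‖(x : E3)‖ = 1 := by simp
  have hz : (x : E3) ≠ 0 := fun h => by simp [h] at hx1
  rw [laplaceBeltrami, (smoothOnS2_zonalPoly p).laplacian_eq_sum hz]
  simp only [fderiv_fderiv_radialExtension_zonalPoly]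
  rw [← Complex.ofReal_sum, zonalPoly]
  congr 1
  have hs : (x : E3) 0 ^ 2 + (x : E3) 1 ^ 2 + (x : E3) 2 ^ 2 = 1 := by
    have := EuclideanSpace.real_norm_sq_eq (x : E3)
    rw [hx1, Fin.sum_univ_three] at this
    linarith
  rw [Fin.sum_univ_three]
  simp [EuclideanSpace.inner_single_right]
  set a := (x : E3) 0
  set b := (x : E3) 1
  set c := (x : E3) 2
  set P := (Polynomial.derivative p).eval c
  set Q := (Polynomial.derivative (Polynomial.derivative p)).eval c
  linear_combination (Q * c ^ 2 + 3 * c * P) * hs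

/-- The mean over the sphere of a zonal polynomial. -/
noncomputable def sphereMean : Polynomial ℝ →ₗ[ℝ] ℝ where
  toFun p := ∫ x : S2, p.eval ((x : E3) 2) ∂sigma
  map_add' p q := by
    simp only [Polynomial.eval_add]
    exact integral_add
      ((p.continuous.comp (by fun_prop)).integrable_of_hasCompactSupport
        (HasCompactSupport.of_compactSpace _))
      ((q.continuous.comp (by fun_prop)).integrable_of_hasCompactSupport
        (HasCompactSupport.of_compactSpace _))
  map_smul' c p := by
    simp only [Polynomial.eval_smul, smul_eq_mul, RingHom.id_apply]
    exact integral_const_mul _ _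

theorem sphereMean_apply (p : Polynomial ℝ) :
    sphereMean p = ∫ x : S2, p.eval ((x : E3) 2) ∂sigma := rfl

theorem integral_zonalPoly (p : Polynomial ℝ) : ∫ x, zonalPoly p x ∂sigma = (sphereMean p : ℂ) :=
  integral_complex_ofReal

theorem sphereMean_laplace (p : Polynomial ℝ) :
    sphereMean (Polynomial.derivative ((1 - Polynomial.X ^ 2) * Polynomial.derivative p)) = 0 := by
  have h := integral_laplaceBeltrami_comm (smoothOnS2_zonalPoly p) (smoothOnS2_zonalPoly 1)
  rw [laplaceBeltrami_zonalPoly, laplaceBeltrami_zonalPoly] at h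
  have h2 : ∀ x, zonalPoly 1 x * zonalPoly
      (Polynomial.derivative ((1 - Polynomial.X ^ 2) * Polynomial.derivative p)) x -
      zonalPoly p x * zonalPoly (Polynomial.derivative
        ((1 - Polynomial.X ^ 2) * Polynomial.derivative 1)) x = zonalPoly
      (Polynomial.derivative ((1 - Polynomial.X ^ 2) * Polynomial.derivative p)) x := by
    intro x; simp [zonalPoly]
  simp only [h2] at h
  rw [integral_zonalPoly] at h
  exact_mod_cast h

/-- **Archimedes' theorem** for polynomials: the third coordinate is uniformly distributed. -/
theorem two_mul_sphereMean (p : Polynomial ℝ) : 2 * sphereMean p = polyIntegral p := by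
  suffices h : (2 : ℝ) • sphereMean = polyIntegral by
    rw [← h]; simp
  refine Polynomial.lhom_ext' fun k => LinearMap.ext_ring ?_
  simp only [LinearMap.comp_apply, LinearMap.smul_apply, smul_eq_mul,
    Polynomial.monomial_one_right_eq_X_pow]
  induction k using Nat.strong_induction_on with
  | _ k ih =>
    rcases k with _ | k
    · simp [sphereMean_apply, polyIntegral_apply]; norm_num
    -- Both functionals vanish on the range of the Legendre operator. Applied to `X^(k+1)`, it
    -- expresses the moment of order `k + 1` through that of order `k - 1`, so agreement on
    -- constants suffices. At `k = 0` the lower term has coefficient `0`.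
    · have hpoly : Polynomial.derivative ((1 - Polynomial.X ^ 2) *
          Polynomial.derivative ((Polynomial.X : Polynomial ℝ) ^ (k + 1))) =
          Polynomial.C ((k + 1) * k : ℝ) * Polynomial.X ^ (k - 1) -
            Polynomial.C ((k + 1) * (k + 2) : ℝ) * Polynomial.X ^ (k + 1) := by
        rcases k with _ | k
        · simp [show (Polynomial.C 2 : Polynomial ℝ) = 2 from rfl, one_add_one_eq_two]
        · simp [show (Polynomial.C 2 : Polynomial ℝ) = 2 from rfl]; ring
      have h1 := sphereMean_laplace (Polynomial.X ^ (k + 1))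
      have h2 := polyIntegral_derivative ((1 - Polynomial.X ^ 2) *
          Polynomial.derivative ((Polynomial.X : Polynomial ℝ) ^ (k + 1)))
      rw [hpoly, map_sub, polyIntegral_C_mul, polyIntegral_C_mul] at h2
      rw [hpoly, map_sub, ← Polynomial.smul_eq_C_mul, ← Polynomial.smul_eq_C_mul, map_smul,
        map_smul, smul_eq_mul, smul_eq_mul] at h1
      have h3 := ih (k - 1) (by omega)
      rw [← h3] at h2
      simp at h2
      have h4 : ((k + 1) * (k + 2) : ℝ) ≠ 0 := by positivity
      refine mul_left_cancel₀ h4 ?_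
      linarith

/-! ### Zonal harmonics as eigenfunctions; projections and propagator on zonal series. -/

theorem laplaceBeltrami_zonalFun (n : ℕ) (x : S2) :
    -laplaceBeltrami (zonalFun n) x = ((n * (n + 1) : ℕ) : ℂ) * zonalFun n x := by
  rw [zonalFun_eq_zonalPoly, laplaceBeltrami_zonalPoly]
  have h : Polynomial.derivative ((1 - Polynomial.X ^ 2) *
      Polynomial.derivative (Polynomial.C √(2 * n + 1) * legendre n)) =
      -(Polynomial.C (n * (n + 1) : ℝ) * (Polynomial.C √(2 * n + 1) * legendre n)) := by
    simp
    linear_combination -Polynomial.C √(2 * n + 1) * legendre_ode n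
  rw [h]
  simp [zonalPoly]

theorem smoothOnS2_zonalFun (n : ℕ) : SmoothOnS2 (zonalFun n) := by
  rw [zonalFun_eq_zonalPoly]; exact smoothOnS2_zonalPoly _

theorem zonalHarmonic_mem_eigenspaceS2 (n : ℕ) : zonalHarmonic n ∈ eigenspaceS2 n :=
  Submodule.subset_span ⟨zonalFun n, smoothOnS2_zonalFun n, laplaceBeltrami_zonalFun n,
    (memLp_zonalFun n).coeFn_toLp⟩

/-- Green's identity with distinct eigenvalues. That identity carries no complex conjugate, but it
computes the inner product because zonal harmonics are real. -/
theorem zonalHarmonic_mem_orthogonal {n m : ℕ} (h : n ≠ m) :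
    zonalHarmonic m ∈ (eigenspaceS2 n)ᗮ := by
  rw [eigenspaceS2, Submodule.mem_orthogonal']
  intro u hu
  induction hu using Submodule.span_induction with
  | zero => simp
  | add u v _ _ hu hv => rw [inner_add_right, hu, hv, add_zero]
  | smul c u _ hu => rw [inner_smul_right, hu, mul_zero]
  | mem u hu =>
    obtain ⟨φ, hφ, he, hae⟩ := hu
    have h1 := integral_laplaceBeltrami_comm hφ (smoothOnS2_zonalFun m)
    have h2 : ∀ x, zonalFun m x * laplaceBeltrami φ x - φ x * laplaceBeltrami (zonalFun m) x =
        (((m * (m + 1) : ℕ) : ℂ) - ((n * (n + 1) : ℕ) : ℂ)) * (zonalFun m x * φ x) := by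
      intro x
      linear_combination -zonalFun m x * he x + φ x * laplaceBeltrami_zonalFun m x
    simp only [h2] at h1
    rw [integral_const_mul] at h1
    have h3 : ((m * (m + 1) : ℕ) : ℂ) - ((n * (n + 1) : ℕ) : ℂ) ≠ 0 := by
      rw [sub_ne_zero, Ne, Nat.cast_inj]
      intro h4
      rcases h.lt_or_gt with h5 | h5 <;> nlinarith
    have h5 := (mul_eq_zero.mp h1).resolve_left h3
    rw [L2.inner_def, ← h5]
    refine integral_congr_ae ?_
    filter_upwards [hae, (memLp_zonalFun m).coeFn_toLp] with x hx hx'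
    rw [hx, zonalHarmonic, hx', RCLike.inner_apply]
    simp [zonalFun, mul_comm]

theorem orthonormal_zonalHarmonic : Orthonormal ℂ zonalHarmonic := by
  refine ⟨fun n => ?_, fun n m h => ?_⟩
  · have h1 : inner ℂ (zonalHarmonic n) (zonalHarmonic n) = 1 := by
      rw [L2.inner_def]
      have h2 : ∫ x, inner ℂ (zonalHarmonic n x) (zonalHarmonic n x) ∂sigma =
          ∫ x, zonalPoly (Polynomial.C (2 * n + 1 : ℝ) * legendre n ^ 2) x ∂sigma := by
        refine integral_congr_ae ?_
        filter_upwards [(memLp_zonalFun n).coeFn_toLp] with x hx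
        have hsq : (√(2 * n + 1 : ℝ)) ^ 2 = 2 * n + 1 := Real.sq_sqrt (by positivity)
        rw [zonalHarmonic, hx, RCLike.inner_apply, zonalPoly, zonalFun, Complex.conj_ofReal,
          ← Complex.ofReal_mul]
        congr 1
        simp only [Polynomial.eval_mul, Polynomial.eval_C, Polynomial.eval_pow]
        linear_combination (legendre n).eval ((x : E3) 2) ^ 2 * hsq
      rw [h2, integral_zonalPoly]
      have h3 := two_mul_sphereMean (Polynomial.C (2 * n + 1 : ℝ) * legendre n ^ 2)
      rw [polyIntegral_C_mul, polyIntegral_legendre_sq] at h3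
      have h4 : (2 * n + 1 : ℝ) * (2 / (2 * n + 1)) = 2 := by field_simp
      rw [h4] at h3
      have h5 : sphereMean (Polynomial.C (2 * n + 1 : ℝ) * legendre n ^ 2) = 1 := by linarith
      rw [h5]; simp
    have h6 : ‖zonalHarmonic n‖ ^ 2 = 1 := by
      rw [← inner_self_eq_norm_sq (𝕜 := ℂ), h1]; exact Complex.one_re
    exact (pow_eq_one_iff_of_nonneg (norm_nonneg _) two_ne_zero).mp h6
  · exact (Submodule.mem_orthogonal _ _).mp (zonalHarmonic_mem_orthogonal h) _
      (zonalHarmonic_mem_eigenspaceS2 n)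

theorem proj_zonalHarmonic_self (n : ℕ) : proj n (zonalHarmonic n) = zonalHarmonic n :=
  Submodule.starProjection_eq_self_iff.mpr
    (Submodule.le_topologicalClosure _ (zonalHarmonic_mem_eigenspaceS2 n))

theorem proj_zonalHarmonic_of_ne {n m : ℕ} (h : n ≠ m) : proj n (zonalHarmonic m) = 0 := by
  rw [proj, Submodule.starProjection_apply_eq_zero_iff, Submodule.orthogonal_closure]
  exact zonalHarmonic_mem_orthogonal h

theorem proj_of_hasSum {a : ℕ → ℂ} {f : L2S2}
    (hf : HasSum (fun n => a n • zonalHarmonic n) f) (n : ℕ) :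
    proj n f = a n • zonalHarmonic n := by
  have h1 := hf.mapL (proj n)
  refine h1.unique ?_
  convert hasSum_single n fun m hm => ?_ using 1
  · simp [proj_zonalHarmonic_self]
  · simp [proj_zonalHarmonic_of_ne (Ne.symm hm)]

theorem hasSum_schrodinger {a : ℕ → ℂ} {f : L2S2}
    (hf : HasSum (fun n => a n • zonalHarmonic n) f) (t : ℝ) :
    HasSum (fun n => (Complex.exp (-(Complex.I * (t : ℂ) * ((n * (n + 1) : ℕ) : ℂ))) * a n) •
      zonalHarmonic n) (schrodinger t f) := by
  have horth := orthonormal_zonalHarmonic.orthogonalFamily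
  have hsum : Summable fun n => a n • zonalHarmonic n := hf.summable
  have h1 : Summable fun n => ‖a n‖ ^ 2 :=
    (horth.summable_iff_norm_sq_summable a).mp hsum
  -- Summability must be proved, as `tsum` would otherwise default to `0`; the phases are
  -- unimodular, so the coefficients remain square summable.
  have h2 : Summable fun n =>
      (Complex.exp (-(Complex.I * (t : ℂ) * ((n * (n + 1) : ℕ) : ℂ))) * a n) •
        zonalHarmonic n := by
    refine (horth.summable_iff_norm_sq_summable _).mpr (h1.congr fun n => ?_)
    have h3 : ‖Complex.exp (-(Complex.I * (t : ℂ) * ((n * (n + 1) : ℕ) : ℂ))) * a n‖ = ‖a n‖ := by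
      rw [norm_mul, Complex.norm_exp]
      simp
    exact congrArg (· ^ 2) h3.symm
  rw [schrodinger]
  simp only [proj_of_hasSum hf, smul_smul]
  exact h2.hasSum

theorem littlewoodPaley_of_hasSum {a : ℕ → ℂ} {f : L2S2}
    (hf : HasSum (fun n => a n • zonalHarmonic n) f) (N : ℕ) :
    littlewoodPaley N f = ∑ n ∈ Finset.Ico N (2 * N), a n • zonalHarmonic n :=
  Finset.sum_congr rfl fun n _ => proj_of_hasSum hf n

theorem norm_sq_littlewoodPaley {a : ℕ → ℂ} {f : L2S2}
    (hf : HasSum (fun n => a n • zonalHarmonic n) f) (N : ℕ) :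
    ‖littlewoodPaley N f‖ ^ 2 = ∑ n ∈ Finset.Ico N (2 * N), ‖a n‖ ^ 2 := by
  rw [littlewoodPaley_of_hasSum hf]
  exact orthonormal_zonalHarmonic.orthogonalFamily.norm_sum a _

/-! ### Orthogonality in time. -/

theorem integral_exp_mul_conj_exp (m n : ℕ) :
    ∫ t in (0 : ℝ)..(2 * Real.pi), Complex.exp (-(Complex.I * (t : ℂ) * (m : ℂ))) *
      (starRingEnd ℂ) (Complex.exp (-(Complex.I * (t : ℂ) * (n : ℂ)))) =
      if m = n then (2 * Real.pi : ℂ) else 0 := by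
  have h1 : ∀ t : ℝ, Complex.exp (-(Complex.I * (t : ℂ) * (m : ℂ))) *
      (starRingEnd ℂ) (Complex.exp (-(Complex.I * (t : ℂ) * (n : ℂ)))) =
      Complex.exp ((Complex.I * ((n : ℂ) - m)) * t) := by
    intro t
    rw [← Complex.exp_conj, ← Complex.exp_add]
    congr 1
    simp
    ring
  simp only [h1]
  split_ifs with h
  · subst h; simp
  · have hne : Complex.I * ((n : ℂ) - m) ≠ 0 :=
      mul_ne_zero Complex.I_ne_zero (sub_ne_zero.mpr (by exact_mod_cast Ne.symm h))
    rw [integral_exp_mul_complex hne]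
    have h2 : Complex.exp ((Complex.I * ((n : ℂ) - m)) * ((2 * Real.pi : ℝ) : ℂ)) = 1 :=
      Complex.exp_eq_one_iff.mpr ⟨(n : ℤ) - m, by push_cast; ring⟩
    rw [h2]; simp

theorem integral_norm_sq_exp_sum {ι : Type*} (S : Finset ι) (ν : ι → ℕ) (z : ι → ℂ) :
    ((∫ t in (0 : ℝ)..(2 * Real.pi),
      ‖∑ p ∈ S, z p * Complex.exp (-(Complex.I * (t : ℂ) * (ν p : ℂ)))‖ ^ 2 : ℝ) : ℂ) =
    ∑ p ∈ S, ∑ q ∈ S, z p * (starRingEnd ℂ) (z q) *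
      if ν p = ν q then (2 * Real.pi : ℂ) else 0 := by
  rw [← intervalIntegral.integral_ofReal]
  have h1 : ∀ t : ℝ, ((‖∑ p ∈ S, z p * Complex.exp (-(Complex.I * (t : ℂ) * (ν p : ℂ)))‖ ^ 2 : ℝ) :
      ℂ) = ∑ p ∈ S, ∑ q ∈ S, z p * (starRingEnd ℂ) (z q) *
        (Complex.exp (-(Complex.I * (t : ℂ) * (ν p : ℂ))) *
          (starRingEnd ℂ) (Complex.exp (-(Complex.I * (t : ℂ) * (ν q : ℂ))))) := by
    intro t
    rw [Complex.ofReal_pow, ← Complex.mul_conj', map_sum, Finset.sum_mul_sum]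
    refine Finset.sum_congr rfl fun p _ => Finset.sum_congr rfl fun q _ => ?_
    rw [map_mul]; ring
  have hc : ∀ p q, Continuous fun t : ℝ => z p * (starRingEnd ℂ) (z q) *
        (Complex.exp (-(Complex.I * (t : ℂ) * (ν p : ℂ))) *
          (starRingEnd ℂ) (Complex.exp (-(Complex.I * (t : ℂ) * (ν q : ℂ))))) := by
    intro p q
    exact continuous_const.mul ((by fun_prop : Continuous fun t : ℝ =>
      Complex.exp (-(Complex.I * (t : ℂ) * (ν p : ℂ)))).mul (Complex.continuous_conj.comp
        (by fun_prop : Continuous fun t : ℝ => Complex.exp (-(Complex.I * (t : ℂ) * (ν q : ℂ))))))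
  simp only [h1]
  rw [intervalIntegral.integral_finsetSum fun p _ =>
    (continuous_finsetSum _ fun q _ => hc p q).intervalIntegrable _ _]
  refine Finset.sum_congr rfl fun p _ => ?_
  rw [intervalIntegral.integral_finsetSum fun q _ => (hc p q).intervalIntegrable _ _]
  refine Finset.sum_congr rfl fun q _ => ?_
  rw [intervalIntegral.integral_const_mul, integral_exp_mul_conj_exp]

/-- Only pairs `(p, q)` of equal frequency survive. With `2 |z_p| |z_q| ≤ |z_p|² + |z_q|²` each
index is charged at most `K` times from either side. -/
theorem integral_norm_sq_exp_sum_le {ι : Type*} (S : Finset ι) (ν : ι → ℕ) (z : ι → ℂ) {K : ℝ}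
    (hK : ∀ k, ((S.filter fun p => ν p = k).card : ℝ) ≤ K) :
    ∫ t in (0 : ℝ)..(2 * Real.pi),
      ‖∑ p ∈ S, z p * Complex.exp (-(Complex.I * (t : ℂ) * (ν p : ℂ)))‖ ^ 2 ≤
      2 * Real.pi * K * ∑ p ∈ S, ‖z p‖ ^ 2 := by
  set J := ∫ t in (0 : ℝ)..(2 * Real.pi),
      ‖∑ p ∈ S, z p * Complex.exp (-(Complex.I * (t : ℂ) * (ν p : ℂ)))‖ ^ 2 with hJ
  have hdiag : ∑ p ∈ S, ∑ q ∈ S, (if ν q = ν p then ‖z p‖ ^ 2 else 0) ≤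
      K * ∑ p ∈ S, ‖z p‖ ^ 2 := by
    rw [Finset.mul_sum]
    refine Finset.sum_le_sum fun p _ => ?_
    rw [← Finset.sum_filter, Finset.sum_const, nsmul_eq_mul]
    exact mul_le_mul_of_nonneg_right (hK _) (by positivity)
  have hpi := Real.pi_pos
  calc J ≤ ‖(J : ℂ)‖ := by rw [Complex.norm_real]; exact le_abs_self _
    _ ≤ ∑ p ∈ S, ∑ q ∈ S, Real.pi * ((if ν q = ν p then ‖z p‖ ^ 2 else 0) +
          (if ν p = ν q then ‖z q‖ ^ 2 else 0)) := by
        rw [hJ, integral_norm_sq_exp_sum]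
        refine (norm_sum_le _ _).trans (Finset.sum_le_sum fun p _ => (norm_sum_le _ _).trans
          (Finset.sum_le_sum fun q _ => ?_))
        by_cases h : ν p = ν q
        · rw [if_pos h, if_pos h.symm, if_pos h]
          have e : ‖(2 * Real.pi : ℂ)‖ = 2 * Real.pi := by
            rw [norm_mul, Complex.norm_real, Real.norm_of_nonneg hpi.le]; simp
          rw [norm_mul, norm_mul, e, RCLike.norm_conj]
          nlinarith [sq_nonneg (‖z p‖ - ‖z q‖)]
        · rw [if_neg h, if_neg (Ne.symm h), if_neg h]; simp
    _ = Real.pi * (∑ p ∈ S, ∑ q ∈ S, (if ν q = ν p then ‖z p‖ ^ 2 else 0)) +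
          Real.pi * (∑ p ∈ S, ∑ q ∈ S, (if ν q = ν p then ‖z p‖ ^ 2 else 0)) := by
        simp only [mul_add, Finset.sum_add_distrib, ← Finset.mul_sum]
        congr 2
        exact Finset.sum_comm
    _ ≤ _ := by nlinarith

/-! ### The spatial bound and the bilinear estimate. -/

theorem integral_zonalFun_sq_mul_sq (n m : ℕ) :
    ∫ x, ‖zonalFun n x * zonalFun m x‖ ^ 2 ∂sigma =
      (2 * n + 1) * (2 * m + 1) * polyIntegral (legendre n ^ 2 * legendre m ^ 2) / 2 := by
  have h1 : ∀ x : S2, ‖zonalFun n x * zonalFun m x‖ ^ 2 =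
      (Polynomial.C ((2 * n + 1) * (2 * m + 1) : ℝ) * (legendre n ^ 2 * legendre m ^ 2)).eval
        ((x : E3) 2) := by
    intro x
    have hn : (√(2 * n + 1 : ℝ)) ^ 2 = 2 * n + 1 := Real.sq_sqrt (by positivity)
    have hm : (√(2 * m + 1 : ℝ)) ^ 2 = 2 * m + 1 := Real.sq_sqrt (by positivity)
    rw [zonalFun, zonalFun, ← Complex.ofReal_mul, Complex.norm_real, Real.norm_eq_abs, sq_abs,
      mul_pow, mul_pow, mul_pow, hn, hm, Polynomial.eval_mul, Polynomial.eval_C,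
      Polynomial.eval_mul, Polynomial.eval_pow, Polynomial.eval_pow]
    ring
  simp only [h1]
  rw [← sphereMean_apply, ← polyIntegral_C_mul, ← two_mul_sphereMean]
  ring

theorem exists_integral_zonalFun_le {ε : ℝ} (hε : 0 < ε) :
    ∃ C : ℝ, 0 < C ∧ ∀ N M : ℕ, 1 ≤ N → 1 ≤ M → ∀ n ∈ Finset.Ico N (2 * N),
      ∀ m ∈ Finset.Ico M (2 * M),
        ∫ x, ‖zonalFun n x * zonalFun m x‖ ^ 2 ∂sigma ≤ C * (M : ℝ) ^ ε := by
  -- The interpolation exponent may not exceed `1`; since `M ≥ 1`, a smaller exponent is no loss.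
  obtain ⟨C, hC, h⟩ := exists_polyIntegral_legendre_sq_mul_sq_le (δ := min ε 1)
    (lt_min hε one_pos) (min_le_right _ _)
  refine ⟨2 * C, by positivity, fun N M hN hM n hn m hm => ?_⟩
  rw [Finset.mem_Ico] at hn hm
  have hM1 : (1 : ℝ) ≤ M := by exact_mod_cast hM
  have hm1 : (2 * m + 1 : ℝ) ≤ 4 * M := by exact_mod_cast (by omega : 2 * m + 1 ≤ 4 * M)
  have h1 := h n m (by omega) (by omega)
  have h2 : (2 * m + 1 : ℝ) ^ (min ε 1) ≤ 4 * (M : ℝ) ^ ε := by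
    calc (2 * m + 1 : ℝ) ^ (min ε 1) ≤ (4 * M : ℝ) ^ (min ε 1) :=
          Real.rpow_le_rpow (by positivity) hm1 (le_min hε.le zero_le_one)
      _ = 4 ^ (min ε 1) * (M : ℝ) ^ (min ε 1) := Real.mul_rpow (by norm_num) (by positivity)
      _ ≤ 4 ^ (1 : ℝ) * (M : ℝ) ^ ε := by
          gcongr
          · norm_num
          · exact min_le_right _ _
          · exact min_le_left _ _
      _ = _ := by rw [Real.rpow_one]
  rw [integral_zonalFun_sq_mul_sq]
  nlinarith

theorem coeFn_sum_smul_zonalHarmonic (S : Finset ℕ) (c : ℕ → ℂ) :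
    (∑ n ∈ S, c n • zonalHarmonic n : L2S2) =ᵐ[sigma] fun x => ∑ n ∈ S, c n * zonalFun n x := by
  classical
  induction S using Finset.induction_on with
  | empty =>
    simp only [Finset.sum_empty]
    exact Lp.coeFn_zero ℂ 2 sigma
  | insert n S hn ih =>
    rw [Finset.sum_insert hn]
    filter_upwards [Lp.coeFn_add (c n • zonalHarmonic n) (∑ n ∈ S, c n • zonalHarmonic n), ih,
      Lp.coeFn_smul (c n) (zonalHarmonic n), (memLp_zonalFun n).coeFn_toLp] with x h1 h2 h3 h4
    rw [h1, Pi.add_apply, h2, h3, Finset.sum_insert hn, Pi.smul_apply, zonalHarmonic, h4,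
      smul_eq_mul]

theorem lintegral_bilinear_le {ι : Type*} (S : Finset ι) (ν : ι → ℕ) (c : ι → ℂ)
    (y : ι → S2 → ℂ) (hy : ∀ p, Continuous (y p)) {K B : ℝ} (hK0 : 0 ≤ K)
    (hK : ∀ k, ((S.filter fun p => ν p = k).card : ℝ) ≤ K)
    (hB : ∀ p ∈ S, ∫ x, ‖y p x‖ ^ 2 ∂sigma ≤ B) :
    ∫⁻ t in Set.Icc (0 : ℝ) (2 * Real.pi), ∫⁻ x,
      ‖∑ p ∈ S, c p * y p x * Complex.exp (-(Complex.I * (t : ℂ) * (ν p : ℂ)))‖ₑ ^ 2 ∂sigma ≤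
      ENNReal.ofReal (2 * Real.pi * K * (B * ∑ p ∈ S, ‖c p‖ ^ 2)) := by
  have hcont : Continuous fun q : ℝ × S2 =>
      ∑ p ∈ S, c p * y p q.2 * Complex.exp (-(Complex.I * (q.1 : ℂ) * (ν p : ℂ))) := by
    refine continuous_finsetSum _ fun p _ => ?_
    have := hy p
    fun_prop
  have hpi := Real.pi_pos
  have henorm : ∀ w : ℂ, ‖w‖ₑ ^ 2 = ENNReal.ofReal (‖w‖ ^ 2) := fun w => by
    rw [ENNReal.ofReal_pow (norm_nonneg _), ofReal_norm]
  have hint : ∀ p, Integrable (fun x => ‖y p x‖ ^ 2) sigma := fun p =>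
    ((hy p).norm.pow 2).integrable_of_hasCompactSupport (HasCompactSupport.of_compactSpace _)
  -- Time is integrated first, at fixed `x`, with the spatial factors as part of the coefficients;
  -- no orthogonality in space is needed.
  rw [lintegral_lintegral_swap (hcont.enorm.measurable.pow_const 2).aemeasurable]
  have hx : ∀ x : S2, ∫⁻ t in Set.Icc (0 : ℝ) (2 * Real.pi),
      ‖∑ p ∈ S, c p * y p x * Complex.exp (-(Complex.I * (t : ℂ) * (ν p : ℂ)))‖ₑ ^ 2 ≤
      ENNReal.ofReal (2 * Real.pi * K * ∑ p ∈ S, ‖c p‖ ^ 2 * ‖y p x‖ ^ 2) := by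
    intro x
    have hc1 : Continuous fun t : ℝ =>
        ‖∑ p ∈ S, c p * y p x * Complex.exp (-(Complex.I * (t : ℂ) * (ν p : ℂ)))‖ ^ 2 :=
      (hcont.comp (Continuous.prodMk_left x)).norm.pow 2
    simp only [henorm]
    rw [← ofReal_integral_eq_lintegral_ofReal hc1.continuousOn.integrableOn_Icc
      (Filter.Eventually.of_forall fun t => by positivity), integral_Icc_eq_integral_Ioc,
      ← intervalIntegral.integral_of_le (by positivity)]
    refine ENNReal.ofReal_le_ofReal
      ((integral_norm_sq_exp_sum_le S ν (fun p => c p * y p x) hK).trans_eq ?_)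
    simp only [norm_mul, mul_pow]
  refine (lintegral_mono hx).trans ?_
  rw [← ofReal_integral_eq_lintegral_ofReal
    ((integrable_finsetSum _ fun p _ => (hint p).const_mul _).const_mul _)
    (Filter.Eventually.of_forall fun x => by positivity)]
  refine ENNReal.ofReal_le_ofReal ?_
  rw [integral_const_mul, integral_finsetSum _ fun p _ => (hint p).const_mul _]
  refine mul_le_mul_of_nonneg_left ?_ (by positivity)
  rw [Finset.mul_sum]
  refine Finset.sum_le_sum fun p hp => ?_
  rw [integral_const_mul, mul_comm]
  exact mul_le_mul_of_nonneg_right (hB p hp) (by positivity)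

theorem spaceTimeL2_littlewoodPaley_mul_le {f g : L2S2} {a b : ℕ → ℂ}
    (hf : HasSum (fun n => a n • zonalHarmonic n) f)
    (hg : HasSum (fun n => b n • zonalHarmonic n) g) {N M : ℕ} {K B : ℝ} (hK0 : 0 ≤ K)
    (hK : ∀ k, ((resonantPairs N M k).card : ℝ) ≤ K)
    (hB : ∀ n ∈ Finset.Ico N (2 * N), ∀ m ∈ Finset.Ico M (2 * M),
      ∫ x, ‖zonalFun n x * zonalFun m x‖ ^ 2 ∂sigma ≤ B) :
    spaceTimeL2 (fun t x =>
        littlewoodPaley N (schrodinger t f) x * littlewoodPaley M (schrodinger t g) x) ≤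
      (ENNReal.ofReal (2 * Real.pi * K *
        (B * (‖littlewoodPaley N f‖ ^ 2 * ‖littlewoodPaley M g‖ ^ 2)))) ^ (1 / 2 : ℝ) := by
  rw [spaceTimeL2]
  refine ENNReal.rpow_le_rpow ?_ (by norm_num)
  have key := lintegral_bilinear_le (Finset.Ico N (2 * N) ×ˢ Finset.Ico M (2 * M))
    (fun p => p.1 * (p.1 + 1) + p.2 * (p.2 + 1)) (fun p => a p.1 * b p.2)
    (fun p x => zonalFun p.1 x * zonalFun p.2 x)
    (fun p => (continuous_zonalFun _).mul (continuous_zonalFun _)) hK0 hK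
    (fun p hp => hB p.1 (Finset.mem_product.mp hp).1 p.2 (Finset.mem_product.mp hp).2)
  have hsum : ∑ p ∈ Finset.Ico N (2 * N) ×ˢ Finset.Ico M (2 * M), ‖a p.1 * b p.2‖ ^ 2 =
      ‖littlewoodPaley N f‖ ^ 2 * ‖littlewoodPaley M g‖ ^ 2 := by
    rw [norm_sq_littlewoodPaley hf, norm_sq_littlewoodPaley hg, Finset.sum_mul_sum,
      Finset.sum_product]
    simp only [norm_mul, mul_pow]
  rw [hsum] at key
  refine le_trans (le_of_eq ?_) key
  refine lintegral_congr fun t => lintegral_congr_ae ?_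
  have h1 := coeFn_sum_smul_zonalHarmonic (Finset.Ico N (2 * N)) fun n =>
    Complex.exp (-(Complex.I * (t : ℂ) * ((n * (n + 1) : ℕ) : ℂ))) * a n
  have h2 := coeFn_sum_smul_zonalHarmonic (Finset.Ico M (2 * M)) fun n =>
    Complex.exp (-(Complex.I * (t : ℂ) * ((n * (n + 1) : ℕ) : ℂ))) * b n
  rw [← littlewoodPaley_of_hasSum (hasSum_schrodinger hf t)] at h1
  rw [← littlewoodPaley_of_hasSum (hasSum_schrodinger hg t)] at h2
  filter_upwards [h1, h2] with x h1 h2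
  rw [h1, h2, Finset.sum_mul_sum, ← Finset.sum_product']
  congr 2
  refine Finset.sum_congr rfl fun p _ => ?_
  have hexp : Complex.exp (-(Complex.I * (t : ℂ) *
      ((p.1 * (p.1 + 1) + p.2 * (p.2 + 1) : ℕ) : ℂ))) =
      Complex.exp (-(Complex.I * (t : ℂ) * ((p.1 * (p.1 + 1) : ℕ) : ℂ))) *
        Complex.exp (-(Complex.I * (t : ℂ) * ((p.2 * (p.2 + 1) : ℕ) : ℂ))) := by
    rw [← Complex.exp_add]
    congr 1
    push_cast
    ring
  rw [hexp]
  ring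

theorem mainTheorem5 (ε : ℝ) (hε : 0 < ε) :
    ∃ C : ℝ, 0 < C ∧
      ∀ s : ℝ, 0 ≤ s → ∀ f ∈ zonalSobolev s, ∀ g ∈ zonalSobolev s,
        ∀ N M : ℕ, (∃ j : ℕ, N = 2 ^ j) → (∃ k : ℕ, M = 2 ^ k) → M ≤ N →
          spaceTimeL2 (fun t x =>
              littlewoodPaley N (schrodinger t f) x * littlewoodPaley M (schrodinger t g) x) ≤
            ENNReal.ofReal
              (C * (M : ℝ) ^ ε * ‖littlewoodPaley N f‖ * ‖littlewoodPaley M g‖) := by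
  obtain ⟨K, hK, hcount⟩ := exists_card_resonantPairs_le hε
  obtain ⟨B, hB, hspace⟩ := exists_integral_zonalFun_le hε
  have hpi := Real.pi_pos
  have hpos : 0 < 2 * Real.pi * K * B := by positivity
  -- Counting and spatial bound each contribute `M^ε` to the squared norm, so the square root leaves
  -- exactly `M^ε`.
  refine ⟨√(2 * Real.pi * K * B), Real.sqrt_pos.mpr hpos, ?_⟩
  rintro s - f ⟨-, a, hf⟩ g ⟨-, b, hg⟩ N M ⟨j, rfl⟩ ⟨k, rfl⟩ -
  have hN : 1 ≤ 2 ^ j := Nat.one_le_two_pow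
  have hM : 1 ≤ 2 ^ k := Nat.one_le_two_pow
  refine (spaceTimeL2_littlewoodPaley_mul_le hf hg (by positivity)
    (fun l => hcount (2 ^ j) (2 ^ k) l hM) (hspace _ _ hN hM)).trans_eq ?_
  rw [ENNReal.ofReal_rpow_of_nonneg (by positivity) (by norm_num), ← Real.sqrt_eq_rpow]
  congr 1
  rw [Real.sqrt_eq_iff_eq_sq (by positivity) (by positivity)]
  simp only [mul_pow]
  rw [Real.sq_sqrt (by positivity)]
  ring
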